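/- Let $\mathbb{H}=\mathbb{R}^3$ be the Heisenberg group with the product $$(x^1,x^2,x^3)(y^1,y^2,y^3)=(x^1+y^1,\;x^2+y^2,\;x^3+y^3+x^1y^2-x^2y^1),$$ with unit $0=(0,0,0)$. For $x\in\mathbb{H}$ write $[x]^{\mathsf h}=\sqrt{|x^1|^2+|x^2|^2}$ and $x^{\mathsf v}=x^3$, and for $r\ge 0$ let $\delta_r(x)=(rx^1,rx^2,r^2x^3)$. Let $\mathsf d$ be a distance on $\mathbb{H}$ that is left-invariant, $\mathsf d(zx,zy)=\mathsf d(x,y)$, and $1$-homogeneous, $\mathsf d(\delta_r x,\delta_r y)=r\,\mathsf d(x,y)$, for all $x,y,z\in\mathbb{H}$ and $r\ge 0$. Let $\mathbb{B}_r(x)$ be the closed $\mathsf d$-ball of centre $x$ and radius $r\ge0$; Borel sets are those of the topology of $\mathsf d$ (which is the Euclidean topology). Put $$\beta_{\mathsf d}=\sup_{\mathsf d(0,y)\le 1}\mathcal L^1\big(\{\sigma\in\mathbb{R}:(0,0,\sigma)\in\mathbb{B}_1(y)\}\big),$$ where $\mathcal L^1$ is Lebesgue measure on $\mathbb{R}$,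 and let the $2$-dimensional spherical Hausdorff measure of $U\subseteq\mathbb{H}$ be $$\mathcal S^2_{\mathsf d}(U)=\sup_{\varepsilon>0}\,\inf\Big\{\sum_{i\ge1}\beta_{\mathsf d}\,r_i^2\;:\;U\subseteq\bigcup_{i\ge1}\mathbb{B}_{r_i}(p_i),\ 0\le r_i\le\varepsilon\ \text{for every } i\Big\}.$$ **Theorem (Area formula).** Let $I\subseteq\mathbb{R}$ be an interval, let $\vartheta:I\to\mathbb{R}$ be continuous, let $\omega:[0,\infty)\to[0,\infty)$ be non-decreasing with $\omega(0^+)=0$, and let $\gamma:I\to\mathbb{H}$ be injective and such that, for every $s,t\in I$, $$[\gamma_s^{-1}\gamma_t]^{\mathsf h}\le\sqrt{|t-s|\,\omega(|t-s|)}\qquad\text{and}\qquad\Big|(\gamma_s^{-1}\gamma_t)^{\mathsf v}-\int_s^t\vartheta(\tau)\,d\tau\Big|\le|t-s|\,\omega(|t-s|).$$ Then: 1. For every Borel set $U\subseteq\mathbb{H}$, as an equality in $[0,\infty]$, $$\mathcal S^2_{\mathsf d}(\gamma(I)\cap U)=\int_I\chi_U(\gamma_\tau)\,|\vartheta(\tau)|\,d\tau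 .$$ 2. For every bounded Borel function $u:\mathbb{H}\to\mathbb{R}$, with $u^+=\max(u,0)$, $$\int_{\gamma(I)}u^+\,d\mathcal S^2_{\mathsf d}=\int_I u^+(\gamma_\tau)\,|\vartheta(\tau)|\,d\tau\quad\text{in }[0,\infty]$$ (and so also for $u^-=(-u)^+$); the function $u$ is $\mathcal S^2_{\mathsf d}$-integrable on $\gamma(I)$ if and only if $\tau\mapsto u(\gamma_\tau)|\vartheta(\tau)|$ is integrable on $I$, and in that case $$\int_{\gamma(I)}u\,d\mathcal S^2_{\mathsf d}=\int_I u(\gamma_\tau)\,|\vartheta(\tau)|\,d\tau .$$ -/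

import Mathlib

open Set MeasureTheory Filter Topology
open scoped ENNReal

/-- The Heisenberg group: the space `ℝ³` of triples `(x1, x2, x3)`. -/
@[ext]
structure Heis where
  x1 : ℝ
  x2 : ℝ
  x3 : ℝ

namespace Heis

/-- The group law `(x¹+y¹, x²+y², x³+y³+(x¹y²-x²y¹))`; the unit is the origin. -/
instance : Mul Heis :=
  ⟨fun x y => ⟨x.x1 + y.x1, x.x2 + y.x2, x.x3 + y.x3 + (x.x1 * y.x2 - x.x2 * y.x1)⟩⟩

instance : One Heis := ⟨⟨0, 0, 0⟩⟩

instance : Inv Heis := ⟨fun x => ⟨-x.x1, -x.x2, -x.x3⟩⟩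

@[simp] theorem mul_x1 (x y : Heis) : (x * y).x1 = x.x1 + y.x1 := rfl
@[simp] theorem mul_x2 (x y : Heis) : (x * y).x2 = x.x2 + y.x2 := rfl
@[simp] theorem mul_x3 (x y : Heis) :
    (x * y).x3 = x.x3 + y.x3 + (x.x1 * y.x2 - x.x2 * y.x1) := rfl
@[simp] theorem one_x1 : (1 : Heis).x1 = 0 := rfl
@[simp] theorem one_x2 : (1 : Heis).x2 = 0 := rfl
@[simp] theorem one_x3 : (1 : Heis).x3 = 0 := rfl
@[simp] theorem inv_x1 (x : Heis) : (x⁻¹).x1 = -x.x1 := rfl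
@[simp] theorem inv_x2 (x : Heis) : (x⁻¹).x2 = -x.x2 := rfl
@[simp] theorem inv_x3 (x : Heis) : (x⁻¹).x3 = -x.x3 := rfl

instance : Group Heis :=
  Group.ofLeftAxioms
    (fun x y z => by ext <;> simp <;> ring)
    (fun x => by ext <;> simp)
    (fun x => by ext <;> simp; ring)

/-- The horizontal gauge, the Euclidean norm of the horizontal part `(x¹, x²)`. -/
noncomputable def hGauge (x : Heis) : ℝ := Real.sqrt (x.x1 ^ 2 + x.x2 ^ 2)

/-- The intrinsic dilations. -/
def dil (r : ℝ) (x : Heis) : Heis := ⟨r * x.x1, r * x.x2, r ^ 2 * x.x3⟩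

/-- The distance `dist` of a metric structure on the Heisenberg group is invariant under left
translations and `1`-homogeneous under dilations. -/
structure IsHomogeneousDist [MetricSpace Heis] : Prop where
  left_invariant : ∀ x y z : Heis, dist (z * x) (z * y) = dist x y
  homogeneous : ∀ (r : ℝ), 0 ≤ r → ∀ x y : Heis, dist (dil r x) (dil r y) = r * dist x y

/-- The geometric constant `β_d`: the largest length that a closed unit ball whose centre has
distance at most `1` from the origin cuts out of the vertical axis. -/
noncomputable def beta [MetricSpace Heis] : ℝ≥0∞ :=
  ⨆ (y : Heis) (_ : dist 1 y ≤ 1), volume {σ : ℝ | (⟨0, 0, σ⟩ : Heis) ∈ Metric.closedBall y 1}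

end Heis

section Spherical

variable {X : Type*} [MetricSpace X]

/-- The size-`ε` approximation of the 2-dimensional spherical measure: the infimum of
`∑ β rᵢ²` over the countable coverings by balls of radii `rᵢ ≤ ε`. -/
noncomputable def sphericalPre (X : Type*) [MetricSpace X] (β : ℝ≥0∞) (ε : ℝ) (U : Set X) :
    ℝ≥0∞ :=
  ⨅ (p : ℕ → X) (r : ℕ → ℝ) (_ : ∀ i, 0 ≤ r i ∧ r i ≤ ε)
    (_ : U ⊆ ⋃ i, Metric.closedBall (p i) (r i)), ∑' i, β * ENNReal.ofReal (r i ^ 2)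

theorem sphericalPre_le {β : ℝ≥0∞} {ε : ℝ} {U : Set X} (p : ℕ → X) (r : ℕ → ℝ)
    (hr : ∀ i, 0 ≤ r i ∧ r i ≤ ε) (hU : U ⊆ ⋃ i, Metric.closedBall (p i) (r i)) :
    sphericalPre X β ε U ≤ ∑' i, β * ENNReal.ofReal (r i ^ 2) :=
  iInf_le_of_le p <| iInf_le_of_le r <| iInf_le_of_le hr <| iInf_le_of_le hU le_rfl

theorem le_sphericalPre {β : ℝ≥0∞} {ε : ℝ} {U : Set X} {a : ℝ≥0∞}
    (h : ∀ (p : ℕ → X) (r : ℕ → ℝ), (∀ i, 0 ≤ r i ∧ r i ≤ ε) →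
      U ⊆ ⋃ i, Metric.closedBall (p i) (r i) → a ≤ ∑' i, β * ENNReal.ofReal (r i ^ 2)) :
    a ≤ sphericalPre X β ε U :=
  le_iInf fun p => le_iInf fun r => le_iInf fun hr => le_iInf fun hU => h p r hr hU

theorem sphericalPre_mono (β : ℝ≥0∞) (ε : ℝ) {U V : Set X} (h : U ⊆ V) :
    sphericalPre X β ε U ≤ sphericalPre X β ε V :=
  le_sphericalPre fun p r hr hV => sphericalPre_le p r hr (h.trans hV)

theorem sphericalPre_anti (β : ℝ≥0∞) {ε ε' : ℝ} (h : ε' ≤ ε) (U : Set X) :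
    sphericalPre X β ε U ≤ sphericalPre X β ε' U :=
  le_sphericalPre fun p r hr hU =>
    sphericalPre_le p r (fun i => ⟨(hr i).1, (hr i).2.trans h⟩) hU

theorem exists_cover_of_sphericalPre_lt {β : ℝ≥0∞} {ε : ℝ} {U : Set X} {a : ℝ≥0∞}
    (h : sphericalPre X β ε U < a) :
    ∃ (p : ℕ → X) (r : ℕ → ℝ), (∀ i, 0 ≤ r i ∧ r i ≤ ε) ∧
      U ⊆ ⋃ i, Metric.closedBall (p i) (r i) ∧ ∑' i, β * ENNReal.ofReal (r i ^ 2) < a := by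
  simp only [sphericalPre, iInf_lt_iff] at h
  obtain ⟨p, r, hr, hU, hlt⟩ := h
  exact ⟨p, r, hr, hU, hlt⟩

theorem sphericalPre_iUnion_le (β : ℝ≥0∞) (ε : ℝ) (s : ℕ → Set X) :
    sphericalPre X β ε (⋃ n, s n) ≤ ∑' n, sphericalPre X β ε (s n) := by
  refine ENNReal.le_of_forall_pos_le_add fun η hη hfin => ?_
  obtain ⟨δ, hδ, hsum⟩ := ENNReal.exists_pos_sum_of_countable
    (ENNReal.coe_pos.2 hη).ne' ℕ
  have hlt : ∀ n, sphericalPre X β ε (s n) < sphericalPre X β ε (s n) + δ n := fun n =>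
    ENNReal.lt_add_right (ENNReal.ne_top_of_tsum_ne_top hfin.ne n)
      (ENNReal.coe_pos.2 (hδ n)).ne'
  choose p r hr hU hle using fun n => exists_cover_of_sphericalPre_lt (hlt n)
  refine (sphericalPre_le (fun k => p k.unpair.1 k.unpair.2) (fun k => r k.unpair.1 k.unpair.2)
    (fun k => hr _ _) ?_).trans ?_
  · refine iUnion_subset fun n x hx => ?_
    obtain ⟨i, hi⟩ := mem_iUnion.1 (hU n hx)
    exact mem_iUnion.2 ⟨Nat.pair n i, by simpa using hi⟩
  · calc ∑' k : ℕ, β * ENNReal.ofReal (r k.unpair.1 k.unpair.2 ^ 2)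
        = ∑' q : ℕ × ℕ, β * ENNReal.ofReal (r q.1 q.2 ^ 2) :=
          Nat.pairEquiv.symm.tsum_eq (fun q : ℕ × ℕ => β * ENNReal.ofReal (r q.1 q.2 ^ 2))
      _ = ∑' n, ∑' i, β * ENNReal.ofReal (r n i ^ 2) := ENNReal.tsum_prod
          (f := fun n i => β * ENNReal.ofReal (r n i ^ 2))
      _ ≤ ∑' n, (sphericalPre X β ε (s n) + δ n) := ENNReal.tsum_le_tsum fun n => (hle n).le
      _ = ∑' n, sphericalPre X β ε (s n) + ∑' n, (δ n : ℝ≥0∞) := ENNReal.tsum_add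
      _ ≤ ∑' n, sphericalPre X β ε (s n) + η := by gcongr

/-- The 2-dimensional spherical (outer) measure `sup_{ε > 0}` of the approximations above. -/
noncomputable def sphericalOuter (X : Type*) [MetricSpace X] [Nonempty X] (β : ℝ≥0∞) :
    OuterMeasure X where
  measureOf U := ⨆ (ε : ℝ) (_ : 0 < ε), sphericalPre X β ε U
  empty := by
    refine le_antisymm (iSup₂_le fun ε hε => ?_) zero_le
    obtain ⟨x⟩ := ‹Nonempty X›
    refine (sphericalPre_le (fun _ => x) (fun _ => 0) (fun _ => ⟨le_rfl, hε.le⟩)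
      (empty_subset _)).trans ?_
    simp
  mono h := iSup₂_mono fun ε _ => sphericalPre_mono β ε h
  iUnion_nat s _ := iSup₂_le fun ε hε => (sphericalPre_iUnion_le β ε s).trans <|
    ENNReal.tsum_le_tsum fun _ => le_iSup₂_of_le ε hε le_rfl

theorem sphericalPre_add_le (β : ℝ≥0∞) {ε : ℝ} {s t : Set X}
    (h : ∀ x ∈ s, ∀ y ∈ t, 2 * ε < dist x y) :
    sphericalPre X β ε s + sphericalPre X β ε t ≤ sphericalPre X β ε (s ∪ t) := by
  classical
  refine le_sphericalPre fun p r hr hU => ?_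
  have key : ∀ v : Set X, v ⊆ s ∪ t → sphericalPre X β ε v ≤
      ∑' i, if (Metric.closedBall (p i) (r i) ∩ v).Nonempty
        then β * ENNReal.ofReal (r i ^ 2) else 0 := by
    intro v hv
    refine (sphericalPre_le p
      (fun i => if (Metric.closedBall (p i) (r i) ∩ v).Nonempty then r i else 0)
      (fun i => ?_) (fun x hx => ?_)).trans (ENNReal.tsum_le_tsum fun i => ?_)
    · have := hr i
      split_ifs
      · exact this
      · exact ⟨le_rfl, this.1.trans this.2⟩
    · obtain ⟨i, hi⟩ := mem_iUnion.1 (hU (hv hx))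
      refine mem_iUnion.2 ⟨i, ?_⟩
      rwa [if_pos ⟨x, hi, hx⟩]
    · split_ifs <;> simp
  refine (add_le_add (key s subset_union_left) (key t subset_union_right)).trans ?_
  rw [← ENNReal.tsum_add]
  refine ENNReal.tsum_le_tsum fun i => ?_
  by_cases h1 : (Metric.closedBall (p i) (r i) ∩ s).Nonempty
  · by_cases h2 : (Metric.closedBall (p i) (r i) ∩ t).Nonempty
    · obtain ⟨x, hx, hxs⟩ := h1
      obtain ⟨y, hy, hyt⟩ := h2
      have hxy := h x hxs y hyt
      have := dist_triangle_right x y (p i)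
      rw [Metric.mem_closedBall] at hx hy
      linarith [(hr i).2]
    · simp [h1, h2]
  · rw [if_neg h1, zero_add]
    split_ifs <;> simp

theorem sphericalOuter_isMetric [Nonempty X] (β : ℝ≥0∞) : (sphericalOuter X β).IsMetric := by
  rintro s t ⟨r, hr0, hr⟩
  refine le_antisymm (measure_union_le _ _) ?_
  obtain ⟨δ, hδ0, hδ⟩ : ∃ δ : ℝ, 0 < δ ∧ ∀ x ∈ s, ∀ y ∈ t, 2 * δ < dist x y := by
    obtain ⟨q, hq0, hq⟩ := ENNReal.lt_iff_exists_nnreal_btwn.1 (pos_iff_ne_zero.2 hr0)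
    have hq0' : (0 : ℝ) < q := by exact_mod_cast hq0
    refine ⟨q / 2, by positivity, fun x hx y hy => ?_⟩
    have h1 : (q : ℝ≥0∞) < edist x y := hq.trans_le (hr x hx y hy)
    rw [edist_nndist] at h1
    have h2 : (q : ℝ) < dist x y := by
      rw [← coe_nndist]; exact_mod_cast h1
    linarith
  change (⨆ (ε : ℝ) (_ : 0 < ε), sphericalPre X β ε s) +
    (⨆ (ε : ℝ) (_ : 0 < ε), sphericalPre X β ε t) ≤
    ⨆ (ε : ℝ) (_ : 0 < ε), sphericalPre X β ε (s ∪ t)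
  refine ENNReal.biSup_add_biSup_le' ⟨1, one_pos⟩ ⟨1, one_pos⟩ fun ε hε ε' hε' => ?_
  have hm : 0 < min δ (min ε ε') := lt_min hδ0 (lt_min hε hε')
  refine le_iSup₂_of_le (min δ (min ε ε')) hm (le_trans (add_le_add
    (sphericalPre_anti β ((min_le_right _ _).trans (min_le_left _ _)) s)
    (sphericalPre_anti β ((min_le_right _ _).trans (min_le_right _ _)) t))
    (sphericalPre_add_le β fun x hx y hy => ?_))
  linarith [hδ x hx y hy, min_le_left δ (min ε ε')]

/-- The spherical measure as a Borel measure: the restriction of `sphericalOuter` to the Borel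
sets, all of which are Carathéodory measurable. -/
noncomputable def sphericalMeasure (X : Type*) [MetricSpace X] [Nonempty X] [MeasurableSpace X]
    [BorelSpace X] (β : ℝ≥0∞) : Measure X :=
  (sphericalOuter X β).toMeasure <| by
    rw [BorelSpace.measurable_eq (α := X)]
    exact (sphericalOuter_isMetric β).borel_le_caratheodory

/-- On Borel sets the measure is given by the defining formula. -/
theorem sphericalMeasure_apply [Nonempty X] [MeasurableSpace X] [BorelSpace X] (β : ℝ≥0∞)
    {U : Set X} (hU : MeasurableSet U) :
    sphericalMeasure X β U = ⨆ (ε : ℝ) (_ : 0 < ε), sphericalPre X β ε U :=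
  toMeasure_apply _ _ hU

end Spherical

/-- The 2-dimensional spherical Hausdorff measure of the Heisenberg group with a given distance,
normalized by `β_d`. -/
noncomputable def Heis.S2 [MetricSpace Heis] [MeasurableSpace Heis] [BorelSpace Heis] :
    Measure Heis :=
  sphericalMeasure Heis Heis.beta

/-!
The two hypotheses say that the curve `γ` has no horizontal velocity and the vertical velocity `ϑ`,
for the dilations of the Heisenberg group. All statements follow once the spherical measure of
`γ '' E` is known to be `∫_E |ϑ|` for measurable `E ⊆ I`
(`Heis.HasVerticalVelocity.S2_image`): then `S2` restricted to `γ '' I` is the image under `γ` of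
the measure `|ϑ| dτ` (`Heis.HasVerticalVelocity.S2_restrict`).

A homogeneous distance is comparable with the coordinates, by compactness of the Euclidean sphere
(`Heis.IsHomogeneousDist.exists_isComparable`). Hence the curve is locally `1/2`-Hölder, with
constants that are arbitrarily small where `ϑ` vanishes. A `1/2`-Hölder curve with constant `√M`
increases measures by at most the factor `β M` (`sphericalPre_image_le`), so the zeros of `ϑ`
contribute nothing.

Near a parameter with `ϑ ≠ 0`, rescaling the parameter by the value of `ϑ` turns `γ` into a curve
which at every scale deviates from the vertical axis, run through with unit speed, by a small
relative error `κ` (`Heis.IsAlmostVertical`). For such curves the spherical measure of the image is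
compared with the Lebesgue measure, with factors that tend to one with `κ`:
* The parameters spent in a ball of radius `r` nearly form a vertical slice of the ball through one
  of its points, so they have measure at most about `β r²`
  (`Heis.IsAlmostVertical.volume_mem_closedBall_le`). Adding up over a covering bounds the Lebesgue
  measure by the spherical one.
* The constant `β` is a supremum, so balls with nearly optimal slices can be placed next to every
  point of the curve and at every small scale (`Heis.IsAlmostVertical.exists_closedBall`). The
  slice of such a ball need not be an interval, so these balls do not tile the curve; but the first
  estimate gives the doubling condition of the Vitali covering theorem, which selects disjoint ones
  that exhaust the curve up to a null set, negligible by the Hölder bound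
  (`Heis.IsAlmostVertical.mul_sphericalPre_le`).

Countably many pieces of this kind cover `{ϑ ≠ 0}` (`measure_le_of_locally_le`), and letting the
factors tend to one gives the formula.
-/

/-! ### Coverings of curves by balls -/

section Spherical

variable {X : Type*} [MetricSpace X]

/-- The size-`ε` approximation of the spherical measure, bundled as an outer measure. -/
noncomputable def sphericalPreOuter (X : Type*) [MetricSpace X] [Nonempty X] (β : ℝ≥0∞) {ε : ℝ}
    (hε : 0 < ε) : OuterMeasure X where
  measureOf U := sphericalPre X β ε U
  empty := by
    refine le_antisymm ?_ zero_le
    obtain ⟨x⟩ := ‹Nonempty X›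
    refine (sphericalPre_le (fun _ => x) (fun _ => 0) (fun _ => ⟨le_rfl, hε.le⟩)
      (empty_subset _)).trans ?_
    simp
  mono h := sphericalPre_mono β ε h
  iUnion_nat s _ := sphericalPre_iUnion_le β ε s

theorem sphericalPreOuter_apply [Nonempty X] (β : ℝ≥0∞) {ε : ℝ} (hε : 0 < ε) (U : Set X) :
    sphericalPreOuter X β hε U = sphericalPre X β ε U := rfl

theorem sphericalPre_closedBall_le (β : ℝ≥0∞) {ε r : ℝ} (hr : 0 ≤ r) (hrε : r ≤ ε) (p : X) :
    sphericalPre X β ε (Metric.closedBall p r) ≤ β * ENNReal.ofReal (r ^ 2) := by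
  refine (sphericalPre_le (fun _ => p) (fun i => if i = 0 then r else 0) (fun i => ?_)
    fun x hx => mem_iUnion.2 ⟨0, by simpa using hx⟩).trans ?_
  · split_ifs
    · exact ⟨hr, hrε⟩
    · exact ⟨le_rfl, hr.trans hrε⟩
  · rw [tsum_eq_single 0 fun i hi => by simp [hi]]
    simp

/-- An outer measure on the line which is at most `K` times the diameter on small sets is at most
`K` times the Lebesgue measure. -/
theorem outerMeasure_le_mul_volume (m : OuterMeasure ℝ) {K r : ℝ≥0∞} (hK : K ≠ 0) (hK' : K ≠ ∞)
    (hr : 0 < r) (h : ∀ s : Set ℝ, Metric.ediam s ≤ r → m s ≤ K * Metric.ediam s) (s : Set ℝ) :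
    m s ≤ K * volume s := by
  have h1 : K⁻¹ • m ≤ OuterMeasure.mkMetric fun x : ℝ≥0∞ => x ^ (1 : ℝ) := by
    refine OuterMeasure.le_mkMetric _ _ r hr fun t ht => ?_
    rw [smul_apply, smul_eq_mul, ENNReal.rpow_one]
    calc K⁻¹ * m t ≤ K⁻¹ * (K * Metric.ediam t) := by gcongr; exact h t ht
      _ = Metric.ediam t := by rw [← mul_assoc, ENNReal.inv_mul_cancel hK hK', one_mul]
  have h2 := h1 s
  rw [← Measure.mkMetric_toOuterMeasure, smul_apply, smul_eq_mul] at h2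
  have h3 : K⁻¹ * m s ≤ volume s := by
    rw [← hausdorffMeasure_real]; exact h2
  calc m s = K * (K⁻¹ * m s) := by rw [← mul_assoc, ENNReal.mul_inv_cancel hK hK', one_mul]
    _ ≤ K * volume s := by gcongr

/-- A curve which is `1/2`-Hölder with constant `√M` increases the measure at most by the factor
`β M`. -/
theorem sphericalPre_image_le [Nonempty X] {β : ℝ≥0∞} (hβ : β ≠ 0) (hβ' : β ≠ ∞) {ε : ℝ}
    (hε : 0 < ε) {f : ℝ → X} {J : Set ℝ} {M : ℝ} (hM : 0 < M)
    (hf : ∀ s ∈ J, ∀ t ∈ J, dist (f s) (f t) ^ 2 ≤ M * |t - s|) {E : Set ℝ} (hE : E ⊆ J) :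
    sphericalPre X β ε (f '' E) ≤ β * ENNReal.ofReal M * volume E := by
  have key := outerMeasure_le_mul_volume
    (OuterMeasure.restrict J (OuterMeasure.comap f (sphericalPreOuter X β hε)))
    (K := β * ENNReal.ofReal M) (r := ENNReal.ofReal (ε ^ 2 / M))
    (mul_ne_zero hβ (by simpa using hM)) (ENNReal.mul_ne_top hβ' ENNReal.ofReal_ne_top)
    (ENNReal.ofReal_pos.2 (by positivity)) ?_ E
  · rwa [OuterMeasure.restrict_apply, inter_eq_self_of_subset_left hE] at key
  intro s hs
  rw [OuterMeasure.restrict_apply, OuterMeasure.comap_apply, sphericalPreOuter_apply]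
  rcases (s ∩ J).eq_empty_or_nonempty with h0 | ⟨x, hxs, hxJ⟩
  · rw [h0, image_empty, ← sphericalPreOuter_apply β hε, measure_empty]
    exact zero_le
  have hfin : Metric.ediam s ≠ ∞ := ne_top_of_le_ne_top ENNReal.ofReal_ne_top hs
  set l := (Metric.ediam s).toReal with hl
  have hl0 : 0 ≤ l := ENNReal.toReal_nonneg
  have hle : l ≤ ε ^ 2 / M := ENNReal.toReal_le_of_le_ofReal (by positivity) hs
  have hMl : M * l ≤ ε ^ 2 := by rwa [le_div_iff₀' hM] at hle
  have hsub : f '' (s ∩ J) ⊆ Metric.closedBall (f x) (√(M * l)) := by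
    rintro _ ⟨t, ⟨hts, htJ⟩, rfl⟩
    rw [Metric.mem_closedBall]
    refine Real.le_sqrt_of_sq_le ((hf t htJ x hxJ).trans ?_)
    have : |x - t| ≤ l := by
      rw [← Real.dist_eq]
      exact Metric.dist_le_diam_of_mem' hfin hxs hts
    gcongr
  refine ((sphericalPre_mono _ _ hsub).trans (sphericalPre_closedBall_le β (Real.sqrt_nonneg _)
    (Real.sqrt_le_iff.2 ⟨hε.le, hMl⟩) _)).trans (le_of_eq ?_)
  rw [Real.sq_sqrt (by positivity), ENNReal.ofReal_mul hM.le, hl, ENNReal.ofReal_toReal hfin,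
    mul_assoc]

theorem continuousOn_of_dist_sq_le {f : ℝ → X} {J : Set ℝ} {M : ℝ}
    (hf : ∀ s ∈ J, ∀ t ∈ J, dist (f s) (f t) ^ 2 ≤ M * |t - s|) : ContinuousOn f J := by
  intro s hs
  refine tendsto_iff_dist_tendsto_zero.2 ?_
  have h1 : Tendsto (fun t => √(M * |s - t|)) (𝓝[J] s) (𝓝 0) := by
    have : Continuous fun t => √(M * |s - t|) := by fun_prop
    simpa using (this.tendsto s).mono_left nhdsWithin_le_nhds
  refine squeeze_zero' (Eventually.of_forall fun _ => dist_nonneg) ?_ h1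
  filter_upwards [self_mem_nhdsWithin] with t ht
  exact Real.le_sqrt_of_sq_le (hf t ht s hs)

end Spherical

/-! ### Homogeneous distances on the Heisenberg group -/

namespace Heis

theorem hGauge_nonneg (x : Heis) : 0 ≤ hGauge x := Real.sqrt_nonneg _

theorem abs_x1_le_hGauge (x : Heis) : |x.x1| ≤ hGauge x :=
  Real.abs_le_sqrt (by nlinarith [sq_nonneg x.x2])

theorem abs_x2_le_hGauge (x : Heis) : |x.x2| ≤ hGauge x :=
  Real.abs_le_sqrt (by nlinarith [sq_nonneg x.x1])

theorem dil_one (r : ℝ) : dil r 1 = 1 := by ext <;> simp [dil]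

section

variable [MetricSpace Heis]

theorem IsHomogeneousDist.dist_eq (hd : IsHomogeneousDist) (x y : Heis) :
    dist x y = dist 1 (x⁻¹ * y) := by
  rw [← hd.left_invariant 1 (x⁻¹ * y) x, mul_one, mul_inv_cancel_left]

theorem IsHomogeneousDist.dist_one_mul_le (hd : IsHomogeneousDist) (x y : Heis) :
    dist 1 (x * y) ≤ dist 1 x + dist 1 y := by
  refine (dist_triangle 1 x (x * y)).trans (le_of_eq ?_)
  rw [hd.dist_eq x, inv_mul_cancel_left]

theorem IsHomogeneousDist.dist_one_inv (hd : IsHomogeneousDist) (x : Heis) :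
    dist 1 x⁻¹ = dist 1 x := by
  rw [dist_comm, hd.dist_eq, inv_inv, mul_one]

theorem IsHomogeneousDist.dist_one_dil (hd : IsHomogeneousDist) {r : ℝ} (hr : 0 ≤ r) (x : Heis) :
    dist 1 (dil r x) = r * dist 1 x := by
  rw [← hd.homogeneous r hr, dil_one]

theorem IsHomogeneousDist.dist_one_dil_abs (hd : IsHomogeneousDist) {r : ℝ} {x y : Heis}
    (hy : y = dil |r| x ∨ y = (dil |r| x)⁻¹) : dist 1 y = |r| * dist 1 x := by
  rcases hy with rfl | rfl
  · exact hd.dist_one_dil (abs_nonneg r) x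
  · rw [hd.dist_one_inv, hd.dist_one_dil (abs_nonneg r) x]

theorem IsHomogeneousDist.dist_one_e1 (hd : IsHomogeneousDist) (a : ℝ) :
    dist 1 (⟨a, 0, 0⟩ : Heis) = |a| * dist 1 (⟨1, 0, 0⟩ : Heis) := by
  refine hd.dist_one_dil_abs ?_
  rcases abs_cases a with h | h
  · left; ext <;> simp [dil, h.1]
  · right; ext <;> simp [dil, h.1]

theorem IsHomogeneousDist.dist_one_e2 (hd : IsHomogeneousDist) (a : ℝ) :
    dist 1 (⟨0, a, 0⟩ : Heis) = |a| * dist 1 (⟨0, 1, 0⟩ : Heis) := by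
  refine hd.dist_one_dil_abs ?_
  rcases abs_cases a with h | h
  · left; ext <;> simp [dil, h.1]
  · right; ext <;> simp [dil, h.1]

theorem IsHomogeneousDist.dist_one_e3 (hd : IsHomogeneousDist) (a : ℝ) :
    dist 1 (⟨0, 0, a⟩ : Heis) = √|a| * dist 1 (⟨0, 0, 1⟩ : Heis) := by
  rw [← abs_of_nonneg (Real.sqrt_nonneg |a|)]
  refine hd.dist_one_dil_abs ?_
  have h0 : (|(√|a|)|) ^ 2 = |a| := by rw [sq_abs, Real.sq_sqrt (abs_nonneg a)]
  rcases abs_cases a with h | h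
  · left; ext <;> simp only [dil, h0] <;> simp [h.1]
  · right; ext <;> simp only [dil, inv_x1, inv_x2, inv_x3, h0] <;> simp [h.1]

/-- The homogeneous norm is controlled by the horizontal gauge and the root of the height. -/
theorem IsHomogeneousDist.exists_dist_one_le (hd : IsHomogeneousDist) :
    ∃ C : ℝ, ∀ x : Heis, dist 1 x ≤ C * (hGauge x + √|x.x3|) := by
  set c₁ := dist 1 (⟨1, 0, 0⟩ : Heis)
  set c₂ := dist 1 (⟨0, 1, 0⟩ : Heis)
  set c₃ := dist 1 (⟨0, 0, 1⟩ : Heis)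
  have h₁ : 0 ≤ c₁ := dist_nonneg
  have h₂ : 0 ≤ c₂ := dist_nonneg
  have h₃ : 0 ≤ c₃ := dist_nonneg
  refine ⟨c₁ + c₂ + c₃, fun x => ?_⟩
  have hx : x = ⟨x.x1, 0, 0⟩ * ⟨0, x.x2, 0⟩ * ⟨0, 0, x.x3 - x.x1 * x.x2⟩ := by
    ext <;> simp
  have h := (hd.dist_one_mul_le (⟨x.x1, 0, 0⟩ * ⟨0, x.x2, 0⟩) ⟨0, 0, x.x3 - x.x1 * x.x2⟩).trans
    (add_le_add_left (hd.dist_one_mul_le ⟨x.x1, 0, 0⟩ ⟨0, x.x2, 0⟩) _)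
  rw [← hx, hd.dist_one_e1, hd.dist_one_e2, hd.dist_one_e3] at h
  have g0 := hGauge_nonneg x
  have g1 := abs_x1_le_hGauge x
  have g2 := abs_x2_le_hGauge x
  have g4 := Real.sqrt_nonneg |x.x3|
  have g3 : √|x.x3 - x.x1 * x.x2| ≤ hGauge x + √|x.x3| := by
    refine Real.sqrt_le_iff.2 ⟨by positivity, ?_⟩
    have e1 := abs_sub x.x3 (x.x1 * x.x2)
    have e2 : |x.x1 * x.x2| ≤ hGauge x ^ 2 := by
      rw [abs_mul, sq]; gcongr
    have e3 := Real.sq_sqrt (abs_nonneg x.x3)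
    nlinarith [mul_nonneg g0 g4]
  calc dist 1 x ≤ _ := h
    _ ≤ (hGauge x + √|x.x3|) * c₁ + (hGauge x + √|x.x3|) * c₂ + (hGauge x + √|x.x3|) * c₃ := by
      gcongr <;> linarith
    _ = _ := by ring

theorem IsHomogeneousDist.continuous_mk (hd : IsHomogeneousDist) :
    Continuous fun q : ℝ × ℝ × ℝ => (⟨q.1, q.2.1, q.2.2⟩ : Heis) := by
  obtain ⟨C, hC⟩ := hd.exists_dist_one_le
  refine continuous_iff_continuousAt.2 fun q => tendsto_iff_dist_tendsto_zero.2 ?_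
  refine squeeze_zero (fun _ => dist_nonneg)
    (g := fun p => C * (√((-q.1 + p.1) ^ 2 + (-q.2.1 + p.2.1) ^ 2) +
      √|(-q.2.2 + p.2.2 + (-q.1 * p.2.1 - -q.2.1 * p.1))|)) (fun p => ?_) ?_
  · rw [dist_comm, hd.dist_eq]
    exact hC _
  · have hc : Continuous fun p : ℝ × ℝ × ℝ =>
        C * (√((-q.1 + p.1) ^ 2 + (-q.2.1 + p.2.1) ^ 2) +
          √|(-q.2.2 + p.2.2 + (-q.1 * p.2.1 - -q.2.1 * p.1))|) := by fun_prop
    have e : C * (√((-q.1 + q.1) ^ 2 + (-q.2.1 + q.2.1) ^ 2) +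
        √|(-q.2.2 + q.2.2 + (-q.1 * q.2.1 - -q.2.1 * q.1))|) = 0 := by
      rw [show -q.2.2 + q.2.2 + (-q.1 * q.2.1 - -q.2.1 * q.1) = 0 by ring]
      simp
    simpa only [e] using hc.tendsto q

theorem IsHomogeneousDist.separableSpace (hd : IsHomogeneousDist) :
    TopologicalSpace.SeparableSpace Heis :=
  (Function.Surjective.denseRange fun x : Heis => ⟨(x.x1, x.x2, x.x3), rfl⟩ :
    DenseRange fun q : ℝ × ℝ × ℝ => (⟨q.1, q.2.1, q.2.2⟩ : Heis)).separableSpace hd.continuous_mk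

/-- The height is controlled by the square of the homogeneous norm: the norm is bounded below on
the Euclidean unit sphere (for the maximum of the coordinates), by compactness, and every point
is a dilation of a point of this sphere. -/
theorem IsHomogeneousDist.exists_abs_x3_le (hd : IsHomogeneousDist) :
    ∃ C : ℝ, ∀ x : Heis, |x.x3| ≤ C * dist 1 x ^ 2 := by
  have hcomp : IsCompact (Metric.sphere (0 : ℝ × ℝ × ℝ) 1) := isCompact_sphere _ _
  have hcont : ContinuousOn (fun q : ℝ × ℝ × ℝ => dist 1 (⟨q.1, q.2.1, q.2.2⟩ : Heis))
      (Metric.sphere (0 : ℝ × ℝ × ℝ) 1) :=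
    (continuous_const.dist hd.continuous_mk).continuousOn
  obtain ⟨q, hq, hmin⟩ := hcomp.exists_isMinOn ⟨(1, 0, 0), by simp [Prod.norm_def]⟩ hcont
  set c := dist 1 (⟨q.1, q.2.1, q.2.2⟩ : Heis) with hc
  have hc0 : 0 < c := by
    refine dist_pos.2 fun h => ?_
    have e1 : q.1 = 0 := by simpa using (congrArg Heis.x1 h).symm
    have e2 : q.2.1 = 0 := by simpa using (congrArg Heis.x2 h).symm
    have e3 : q.2.2 = 0 := by simpa using (congrArg Heis.x3 h).symm
    have : q = 0 := Prod.ext e1 (Prod.ext e2 e3)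
    simp [this] at hq
  refine ⟨(c ^ 2)⁻¹, fun x => ?_⟩
  set ρ := max |x.x1| (max |x.x2| √|x.x3|) with hρ
  have h3 : √|x.x3| ≤ ρ := (le_max_right _ _).trans (le_max_right _ _)
  have hρ0 : 0 ≤ ρ := (Real.sqrt_nonneg _).trans h3
  have h3' : |x.x3| ≤ ρ ^ 2 := by
    rw [← Real.sq_sqrt (abs_nonneg x.x3)]; gcongr
  rcases hρ0.eq_or_lt with h0 | h0
  · rw [← h0] at h3'
    refine h3'.trans ?_
    rw [zero_pow two_ne_zero]; positivity
  have hsph : ((ρ⁻¹ * x.x1, ρ⁻¹ * x.x2, ρ⁻¹ ^ 2 * x.x3) : ℝ × ℝ × ℝ) ∈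
      Metric.sphere (0 : ℝ × ℝ × ℝ) 1 := by
    rw [mem_sphere_zero_iff_norm]
    simp only [Prod.norm_def, Real.norm_eq_abs, abs_mul, abs_pow, abs_inv, abs_of_pos h0]
    have a1 : ρ⁻¹ * |x.x1| ≤ 1 := by
      rw [inv_mul_le_iff₀ h0, mul_one]; exact le_max_left _ _
    have a2 : ρ⁻¹ * |x.x2| ≤ 1 := by
      rw [inv_mul_le_iff₀ h0, mul_one]; exact (le_max_left _ _).trans (le_max_right _ _)
    have a3 : ρ⁻¹ ^ 2 * |x.x3| ≤ 1 := by
      rw [inv_pow, inv_mul_le_iff₀ (by positivity), mul_one]; exact h3'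
    refine le_antisymm (max_le a1 (max_le a2 a3)) ?_
    have hcase : ρ = |x.x1| ∨ ρ = |x.x2| ∨ ρ = √|x.x3| := by
      rcases max_choice |x.x1| (max |x.x2| √|x.x3|) with h | h
      · exact Or.inl h
      · rcases max_choice |x.x2| √|x.x3| with h' | h'
        · exact Or.inr (Or.inl (h.trans h'))
        · exact Or.inr (Or.inr (h.trans h'))
    rcases hcase with h | h | h
    · refine le_max_of_le_left ?_
      rw [← h, inv_mul_cancel₀ h0.ne']
    · refine le_max_of_le_right (le_max_of_le_left ?_)
      rw [← h, inv_mul_cancel₀ h0.ne']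
    · refine le_max_of_le_right (le_max_of_le_right ?_)
      rw [← Real.sq_sqrt (abs_nonneg x.x3), ← h, ← mul_pow, inv_mul_cancel₀ h0.ne', one_pow]
  have hle : c ≤ dist 1 (dil ρ⁻¹ x) := hmin hsph
  rw [hd.dist_one_dil (by positivity), le_inv_mul_iff₀ h0] at hle
  rw [le_inv_mul_iff₀ (by positivity), ← mul_comm]
  calc |x.x3| * c ^ 2 ≤ ρ ^ 2 * c ^ 2 := by gcongr
    _ = (ρ * c) ^ 2 := by ring
    _ ≤ dist 1 x ^ 2 := by gcongr

/-- The constant `C` compares the distance from the origin with the coordinates, in the two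
directions that are needed: the norm is bounded above by the coordinates, and bounds the height. -/
def IsComparable (C : ℝ) : Prop :=
  1 ≤ C ∧ (∀ x : Heis, dist 1 x ≤ C * (hGauge x + √|x.x3|)) ∧
    ∀ x : Heis, |x.x3| ≤ C * dist 1 x ^ 2

theorem IsHomogeneousDist.exists_isComparable (hd : IsHomogeneousDist) :
    ∃ C : ℝ, IsComparable C := by
  obtain ⟨A, hA⟩ := hd.exists_dist_one_le
  obtain ⟨B, hB⟩ := hd.exists_abs_x3_le
  refine ⟨max 1 (max A B), le_max_left _ _, fun x => (hA x).trans ?_, fun x => (hB x).trans ?_⟩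
  · have := hGauge_nonneg x
    gcongr
    exact (le_max_left _ _).trans (le_max_right _ _)
  · gcongr
    exact (le_max_right _ _).trans (le_max_right _ _)

/-- The part of the vertical axis in the closed unit ball of centre `y`. -/
def axisSlice (y : Heis) : Set ℝ := {σ : ℝ | (⟨0, 0, σ⟩ : Heis) ∈ Metric.closedBall y 1}

theorem volume_axisSlice_le_beta {y : Heis} (hy : dist 1 y ≤ 1) : volume (axisSlice y) ≤ beta :=
  le_iSup₂_of_le (f := fun y (_ : dist 1 y ≤ 1) => volume (axisSlice y)) y hy le_rfl

theorem IsComparable.abs_le_of_mem_axisSlice {C : ℝ} (hC : IsComparable C) {y : Heis}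
    (hy : dist 1 y ≤ 1) {σ : ℝ} (hσ : σ ∈ axisSlice y) : |σ| ≤ 4 * C := by
  have h1 : dist 1 (⟨0, 0, σ⟩ : Heis) ≤ 2 := by
    have := dist_triangle_right 1 (⟨0, 0, σ⟩ : Heis) y
    have h2 : dist (⟨0, 0, σ⟩ : Heis) y ≤ 1 := hσ
    linarith
  calc |σ| ≤ C * dist 1 (⟨0, 0, σ⟩ : Heis) ^ 2 := hC.2.2 ⟨0, 0, σ⟩
    _ ≤ C * 2 ^ 2 := by have := hC.1; gcongr
    _ = 4 * C := by ring

theorem IsComparable.beta_ne_top {C : ℝ} (hC : IsComparable C) : beta ≠ ∞ := by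
  refine ne_top_of_le_ne_top (b := volume (Icc (-(4 * C)) (4 * C))) (by simp) ?_
  exact iSup₂_le fun y hy => measure_mono fun σ hσ =>
    abs_le.1 (hC.abs_le_of_mem_axisSlice hy hσ)

theorem IsComparable.beta_ne_zero {C : ℝ} (hC : IsComparable C) : beta ≠ 0 := by
  have hC0 : 0 < C := one_pos.trans_le hC.1
  have h1 : Icc (-(C ^ 2)⁻¹) (C ^ 2)⁻¹ ⊆ axisSlice 1 := by
    intro σ hσ
    have h2 : √|σ| ≤ C⁻¹ := by
      refine Real.sqrt_le_iff.2 ⟨by positivity, ?_⟩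
      rw [inv_pow]; exact abs_le.2 hσ
    change dist _ 1 ≤ 1
    rw [dist_comm]
    refine (hC.2.1 _).trans ?_
    have h3 : hGauge (⟨0, 0, σ⟩ : Heis) = 0 := by simp [hGauge]
    rw [h3, zero_add]
    calc C * √|σ| ≤ C * C⁻¹ := by gcongr
      _ = 1 := mul_inv_cancel₀ hC0.ne'
  have h4 := (measure_mono h1).trans (volume_axisSlice_le_beta (by simp : dist (1 : Heis) 1 ≤ 1))
  refine (lt_of_lt_of_le ?_ h4).ne'
  rw [Real.volume_Icc, ENNReal.ofReal_pos]
  have : 0 < (C ^ 2)⁻¹ := by positivity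
  linarith

end

end Heis

/-! ### Almost vertical curves -/

theorem volume_rescale {r : ℝ} (hr : 0 < r) (t : ℝ) (A : Set ℝ) :
    volume {s : ℝ | (r ^ 2)⁻¹ * (s - t) ∈ A} = ENNReal.ofReal (r ^ 2) * volume A := by
  have h : {s : ℝ | (r ^ 2)⁻¹ * (s - t) ∈ A} =
      (fun s => s + -t) ⁻¹' (((r ^ 2)⁻¹ * ·) ⁻¹' A) := by
    ext s; simp [sub_eq_add_neg]
  have hr2 : 0 < r ^ 2 := by positivity
  rw [h, measure_preimage_add_right, Real.volume_preimage_mul_left (by positivity), inv_inv,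
    abs_of_pos hr2]

theorem Real.sqrt_le_sqrt_mul {a b r : ℝ} (hb : 0 ≤ b) (hr : 0 ≤ r) (h : a ≤ b * r ^ 2) :
    √a ≤ √b * r := by
  refine (Real.sqrt_le_sqrt h).trans (le_of_eq ?_)
  rw [Real.sqrt_mul hb, Real.sqrt_sq hr]

namespace Heis

/-- On `J`, the curve `γ` moves along the vertical axis with unit speed, up to a relative error `κ`
at every scale: the horizontal displacement is small compared to the square root of the elapsed
time and the vertical one is close to the elapsed time. -/
def IsAlmostVertical (κ : ℝ) (γ : ℝ → Heis) (J : Set ℝ) : Prop :=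
  ∀ s ∈ J, ∀ t ∈ J, hGauge ((γ s)⁻¹ * γ t) ≤ √(κ * |t - s|) ∧
    |((γ s)⁻¹ * γ t).x3 - (t - s)| ≤ κ * |t - s|

theorem IsAlmostVertical.mono {κ : ℝ} {γ : ℝ → Heis} {J J' : Set ℝ}
    (h : IsAlmostVertical κ γ J) (hJ : J' ⊆ J) : IsAlmostVertical κ γ J' :=
  fun s hs t ht => h s (hJ hs) t (hJ ht)

/-- The factor by which a ball has to be enlarged to swallow the deviation of a `κ`-almost vertical
curve from its vertical tangent. -/
noncomputable def distortion (C κ : ℝ) : ℝ := 1 + 2 * C * √(8 * C * κ)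

theorem one_le_distortion {C κ : ℝ} (hC : 1 ≤ C) : 1 ≤ distortion C κ := by
  have : 0 ≤ 2 * C * √(8 * C * κ) := by positivity
  rw [distortion]; linarith

variable [MetricSpace Heis]

theorem IsComparable.dist_axis_le {C : ℝ} (hC : IsComparable C) (hd : IsHomogeneousDist)
    {κ τ : ℝ} {w : Heis} (h1 : hGauge w ≤ √(κ * |τ|)) (h2 : |w.x3 - τ| ≤ κ * |τ|) :
    dist w (⟨0, 0, τ⟩ : Heis) ≤ 2 * C * √(κ * |τ|) := by
  rw [hd.dist_eq]
  refine (hC.2.1 _).trans ?_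
  have e1 : hGauge (w⁻¹ * ⟨0, 0, τ⟩) = hGauge w := by simp [hGauge]
  have e2 : |(w⁻¹ * ⟨0, 0, τ⟩ : Heis).x3| = |w.x3 - τ| := by
    rw [abs_sub_comm]; simp [sub_eq_neg_add]
  rw [e1, e2]
  have hC1 := hC.1
  calc C * (hGauge w + √|w.x3 - τ|) ≤ C * (√(κ * |τ|) + √(κ * |τ|)) := by gcongr
    _ = _ := by ring

/-- If the height and the horizontal displacement are controlled by the elapsed time, the curve is
`1/2`-Hölder. -/
theorem IsComparable.dist_sq_le {C : ℝ} (hC : IsComparable C) (hd : IsHomogeneousDist)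
    {a : ℝ} (ha : 0 ≤ a) {x y : Heis} (h1 : hGauge (x⁻¹ * y) ≤ √a)
    (h2 : |(x⁻¹ * y).x3| ≤ 2 * a) : dist x y ^ 2 ≤ 9 * C ^ 2 * a := by
  have hC1 := hC.1
  have h3 : √|(x⁻¹ * y).x3| ≤ 2 * √a := by
    refine Real.sqrt_le_iff.2 ⟨by positivity, ?_⟩
    rw [mul_pow, Real.sq_sqrt ha]; linarith
  have h4 : dist x y ≤ 3 * C * √a := by
    rw [hd.dist_eq]
    refine (hC.2.1 _).trans ?_
    calc C * (hGauge (x⁻¹ * y) + √|(x⁻¹ * y).x3|) ≤ C * (√a + 2 * √a) := by gcongr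
      _ = _ := by ring
  calc dist x y ^ 2 ≤ (3 * C * √a) ^ 2 := by gcongr
    _ = _ := by rw [mul_pow, Real.sq_sqrt ha]; ring

theorem IsAlmostVertical.dist_sq_le {κ C : ℝ} {γ : ℝ → Heis} {J : Set ℝ}
    (h : IsAlmostVertical κ γ J) (hκ : κ ≤ 1 / 2) (hC : IsComparable C)
    (hd : IsHomogeneousDist) : ∀ s ∈ J, ∀ t ∈ J, dist (γ s) (γ t) ^ 2 ≤ 9 * C ^ 2 * |t - s| := by
  intro s hs t ht
  obtain ⟨h1, h2⟩ := h s hs t ht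
  have h0 := abs_nonneg (t - s)
  refine hC.dist_sq_le hd h0 (h1.trans (Real.sqrt_le_sqrt (by nlinarith))) ?_
  have := abs_sub_abs_le_abs_sub ((γ s)⁻¹ * γ t).x3 (t - s)
  nlinarith

/-- The parameters which an almost vertical curve spends in a ball have measure at most
`β r²`, up to the distortion: seen from one of its points in the ball, the curve is close to the
vertical axis, so these parameters lie in a vertical slice of a slightly larger ball. -/
theorem IsAlmostVertical.volume_mem_closedBall_le {κ C : ℝ} {γ : ℝ → Heis} {J : Set ℝ}
    (h : IsAlmostVertical κ γ J) (hκ0 : 0 ≤ κ) (hκ : κ ≤ 1 / 2) (hC : IsComparable C)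
    (hd : IsHomogeneousDist) (p : Heis) {r : ℝ} (hr : 0 ≤ r) :
    volume {s ∈ J | γ s ∈ Metric.closedBall p r} ≤
      beta * ENNReal.ofReal ((distortion C κ * r) ^ 2) := by
  have hC1 := hC.1
  have hq1 := one_le_distortion (κ := κ) hC1
  rcases {s ∈ J | γ s ∈ Metric.closedBall p r}.eq_empty_or_nonempty with h0 | ⟨s, hsJ, hs⟩
  · rw [h0, measure_empty]; exact zero_le
  have hs' : dist (γ s) p ≤ r := hs
  -- two parameters of the same ball differ by at most a multiple of `r ^ 2`
  have hτ : ∀ t ∈ J, γ t ∈ Metric.closedBall p r → |t - s| ≤ 8 * C * r ^ 2 := by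
    intro t htJ ht
    have h1 : dist (γ s) (γ t) ≤ 2 * r := by
      have ht' : dist (γ t) p ≤ r := ht
      linarith [dist_triangle_right (γ s) (γ t) p]
    rw [hd.dist_eq] at h1
    have h2 := (h s hsJ t htJ).2
    have h3 : |((γ s)⁻¹ * γ t).x3| ≤ C * (2 * r) ^ 2 :=
      (hC.2.2 _).trans (by gcongr)
    have h4 := abs_sub_abs_le_abs_sub (t - s) ((γ s)⁻¹ * γ t).x3
    rw [abs_sub_comm (t - s) ((γ s)⁻¹ * γ t).x3] at h4
    nlinarith [abs_nonneg (t - s)]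
  rcases hr.eq_or_lt with rfl | hr0
  · refine (measure_mono (t := {s}) fun t ht => ?_).trans (by simp)
    have := hτ t ht.1 ht.2
    have h5 : |t - s| ≤ 0 := by simpa using this
    exact sub_eq_zero.1 (abs_nonpos_iff.1 h5)
  set R := distortion C κ * r with hR
  have hRr : r ≤ R := le_mul_of_one_le_left hr hq1
  have hR0 : 0 < R := hr0.trans_le hRr
  set y := dil R⁻¹ ((γ s)⁻¹ * p) with hy
  have hy1 : dist 1 y ≤ 1 := by
    rw [hy, hd.dist_one_dil (by positivity), ← hd.dist_eq, inv_mul_le_iff₀ hR0, mul_one]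
    exact hs'.trans hRr
  have hsub : {s ∈ J | γ s ∈ Metric.closedBall p r} ⊆
      {t : ℝ | (R ^ 2)⁻¹ * (t - s) ∈ axisSlice y} := by
    rintro t ⟨htJ, ht⟩
    have ht' : dist (γ t) p ≤ r := ht
    have e1 : (⟨0, 0, (R ^ 2)⁻¹ * (t - s)⟩ : Heis) = dil R⁻¹ ⟨0, 0, t - s⟩ := by
      ext <;> simp [dil]
    change dist (⟨0, 0, (R ^ 2)⁻¹ * (t - s)⟩ : Heis) y ≤ 1
    rw [e1, hy, hd.homogeneous _ (by positivity), inv_mul_le_iff₀ hR0, mul_one]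
    obtain ⟨h1, h2⟩ := h s hsJ t htJ
    have h3 := hC.dist_axis_le hd h1 h2
    have h4 : √(κ * |t - s|) ≤ √(8 * C * κ) * r := by
      refine Real.sqrt_le_sqrt_mul (by positivity) hr ?_
      nlinarith [hτ t htJ ht]
    have h5 : dist ((γ s)⁻¹ * γ t) ((γ s)⁻¹ * p) ≤ r := by rwa [hd.left_invariant]
    calc dist (⟨0, 0, t - s⟩ : Heis) ((γ s)⁻¹ * p)
        ≤ dist ((γ s)⁻¹ * γ t) (⟨0, 0, t - s⟩ : Heis) +
          dist ((γ s)⁻¹ * γ t) ((γ s)⁻¹ * p) := dist_triangle_left _ _ _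
      _ ≤ 2 * C * (√(8 * C * κ) * r) + r := by
          refine add_le_add (h3.trans ?_) h5
          gcongr
      _ = R := by rw [hR, distortion]; ring
  calc _ ≤ _ := measure_mono hsub
    _ = ENNReal.ofReal (R ^ 2) * volume (axisSlice y) := volume_rescale hR0 _ _
    _ ≤ ENNReal.ofReal (R ^ 2) * beta := by gcongr; exact volume_axisSlice_le_beta hy1
    _ = _ := mul_comm _ _

theorem IsAlmostVertical.volume_le_sphericalPre {κ C : ℝ} {γ : ℝ → Heis} {J : Set ℝ}
    (h : IsAlmostVertical κ γ J) (hκ0 : 0 ≤ κ) (hκ : κ ≤ 1 / 2) (hC : IsComparable C)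
    (hd : IsHomogeneousDist) (ε : ℝ) {E : Set ℝ} (hE : E ⊆ J) :
    volume E ≤ ENNReal.ofReal (distortion C κ ^ 2) * sphericalPre Heis beta ε (γ '' E) := by
  have hq1 := one_le_distortion (κ := κ) hC.1
  have hq : ENNReal.ofReal (distortion C κ ^ 2) ≠ 0 := by
    rw [Ne, ENNReal.ofReal_eq_zero, not_le]; positivity
  rw [← ENNReal.div_le_iff' hq ENNReal.ofReal_ne_top]
  refine le_sphericalPre fun p r hr hU => ENNReal.div_le_of_le_mul' ?_
  have hsub : E ⊆ ⋃ i, {s ∈ J | γ s ∈ Metric.closedBall (p i) (r i)} := by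
    intro s hs
    obtain ⟨i, hi⟩ := mem_iUnion.1 (hU (mem_image_of_mem γ hs))
    exact mem_iUnion.2 ⟨i, hE hs, hi⟩
  refine ((measure_mono hsub).trans (measure_iUnion_le _)).trans ?_
  rw [← ENNReal.tsum_mul_left]
  refine ENNReal.tsum_le_tsum fun i => ?_
  refine (h.volume_mem_closedBall_le hκ0 hκ hC hd (p i) (hr i).1).trans (le_of_eq ?_)
  rw [mul_pow, ENNReal.ofReal_mul (by positivity)]
  ring

/-- Small balls of centre `γ t * dil r y` capture, up to the distortion, as many parameters of an
almost vertical curve as the vertical slice of the unit ball of centre `y` suggests. -/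
theorem IsAlmostVertical.exists_closedBall {κ C : ℝ} {γ : ℝ → Heis} {O : Set ℝ}
    (h : IsAlmostVertical κ γ O) (hκ0 : 0 ≤ κ) (hC : IsComparable C)
    (hd : IsHomogeneousDist) (hO : IsOpen O) {t : ℝ} (ht : t ∈ O) {y : Heis} (hy : dist 1 y ≤ 1)
    {δ : ℝ} (hδ : 0 < δ) :
    ∃ (p : Heis) (ρ : ℝ), 0 < ρ ∧ ρ ≤ δ ∧ dist (γ t) p ≤ ρ ∧
      ENNReal.ofReal (ρ ^ 2) * volume (axisSlice y) ≤ ENNReal.ofReal (distortion C κ ^ 2) *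
        volume {s ∈ O | γ s ∈ Metric.closedBall p ρ} := by
  have hC1 := hC.1
  have hq1 := one_le_distortion (κ := κ) hC1
  set q := distortion C κ with hq
  obtain ⟨e, he, hball⟩ := Metric.isOpen_iff.1 hO t ht
  obtain ⟨r, ⟨hrδ, hre⟩, hr⟩ : ∃ r : ℝ, (q * r < δ ∧ 4 * C * r ^ 2 < e) ∧ 0 < r := by
    have h1 : ∀ᶠ r : ℝ in 𝓝 0, q * r < δ :=
      (by fun_prop : Continuous fun r : ℝ => q * r).tendsto 0 |>.eventually_lt_const (by simpa)
    have h2 : ∀ᶠ r : ℝ in 𝓝 0, 4 * C * r ^ 2 < e :=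
      (by fun_prop : Continuous fun r : ℝ => 4 * C * r ^ 2).tendsto 0
        |>.eventually_lt_const (by simpa)
    exact (((h1.and h2).filter_mono nhdsWithin_le_nhds).and
      (self_mem_nhdsWithin : Ioi (0 : ℝ) ∈ 𝓝[>] 0)).exists
  have hρ0 : 0 < q * r := by positivity
  have hrρ : r ≤ q * r := le_mul_of_one_le_left hr.le hq1
  refine ⟨γ t * dil r y, q * r, hρ0, hrδ.le, ?_, ?_⟩
  · rw [hd.dist_eq, inv_mul_cancel_left, hd.dist_one_dil hr.le]
    nlinarith
  have hsub : {s : ℝ | (r ^ 2)⁻¹ * (s - t) ∈ axisSlice y} ⊆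
      {s ∈ O | γ s ∈ Metric.closedBall (γ t * dil r y) (q * r)} := by
    intro s hs
    have hs1 : |s - t| ≤ 4 * C * r ^ 2 := by
      have := hC.abs_le_of_mem_axisSlice hy hs
      rwa [abs_mul, abs_of_pos (by positivity), inv_mul_le_iff₀ (by positivity), mul_comm] at this
    have hsO : s ∈ O := hball (by rw [Metric.mem_ball, Real.dist_eq]; linarith)
    refine ⟨hsO, ?_⟩
    obtain ⟨h1, h2⟩ := h t ht s hsO
    have h3 := hC.dist_axis_le hd h1 h2
    have h4 : √(κ * |s - t|) ≤ √(8 * C * κ) * r := by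
      refine Real.sqrt_le_sqrt_mul (by positivity) hr.le ?_
      have : κ * |s - t| ≤ κ * (4 * C * r ^ 2) := by gcongr
      have : 0 ≤ κ * (4 * C * r ^ 2) := by positivity
      linarith
    have e1 : (⟨0, 0, s - t⟩ : Heis) = dil r ⟨0, 0, (r ^ 2)⁻¹ * (s - t)⟩ := by
      ext <;> simp [dil, hr.ne']
    have h5 : dist (⟨0, 0, s - t⟩ : Heis) (dil r y) ≤ r := by
      rw [e1, hd.homogeneous _ hr.le]
      have : dist (⟨0, 0, (r ^ 2)⁻¹ * (s - t)⟩ : Heis) y ≤ 1 := hs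
      nlinarith
    rw [Metric.mem_closedBall, ← hd.left_invariant _ _ (γ t)⁻¹, inv_mul_cancel_left]
    calc dist ((γ t)⁻¹ * γ s) (dil r y)
        ≤ dist ((γ t)⁻¹ * γ s) (⟨0, 0, s - t⟩ : Heis) +
          dist (⟨0, 0, s - t⟩ : Heis) (dil r y) := dist_triangle _ _ _
      _ ≤ 2 * C * (√(8 * C * κ) * r) + r := by
          refine add_le_add (h3.trans ?_) h5
          gcongr
      _ = q * r := by rw [hq, distortion]; ring
  calc ENNReal.ofReal ((q * r) ^ 2) * volume (axisSlice y)
      = ENNReal.ofReal (q ^ 2) * volume {s : ℝ | (r ^ 2)⁻¹ * (s - t) ∈ axisSlice y} := by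
        rw [volume_rescale hr, mul_pow, ENNReal.ofReal_mul (by positivity), mul_assoc]
    _ ≤ _ := by gcongr

/-! ### Efficient coverings of almost vertical curves -/

theorem IsComparable.nine_mul_sq_pos {C : ℝ} (hC : IsComparable C) : 0 < 9 * C ^ 2 := by
  have := hC.1
  positivity

/-- Covering an almost vertical curve efficiently, with balls whose vertical slices have length at
least `a`: by the Vitali covering theorem there are disjoint such balls which exhaust almost all
parameters, and the remaining null set of parameters is negligible because the curve is
`1/2`-Hölder. -/
theorem IsAlmostVertical.mul_sphericalPre_le [MeasurableSpace Heis] [BorelSpace Heis]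
    {κ C : ℝ} {γ : ℝ → Heis} {O : Set ℝ} (h : IsAlmostVertical κ γ O) (hκ0 : 0 ≤ κ)
    (hκ : κ ≤ 1 / 2) (hC : IsComparable C) (hd : IsHomogeneousDist) (hO : IsOpen O)
    (hfin : volume O ≠ ∞) {ε : ℝ} (hε : 0 < ε) {a : ℝ≥0∞} (ha0 : a ≠ 0) (ha : a < beta) :
    a * sphericalPre Heis beta ε (γ '' O) ≤
      beta * (ENNReal.ofReal (distortion C κ ^ 2) * volume O) := by
  have hq1 := one_le_distortion (κ := κ) hC.1
  set q := distortion C κ with hq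
  set Q := ENNReal.ofReal (q ^ 2) with hQ
  have hβ := hC.beta_ne_top
  have ha' : a ≠ ∞ := ne_top_of_lt ha
  obtain ⟨y, hy, hay⟩ : ∃ y : Heis, dist 1 y ≤ 1 ∧ a < volume (axisSlice y) := by
    obtain ⟨y, hy⟩ := lt_iSup_iff.1 ha
    obtain ⟨hy1, hy2⟩ := lt_iSup_iff.1 hy
    exact ⟨y, hy1, hy2⟩
  have hcont : ContinuousOn γ O := continuousOn_of_dist_sq_le (h.dist_sq_le hκ hC hd)
  have hmeas : AEMeasurable γ (volume.restrict O) := hcont.aemeasurable hO.measurableSet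
  have := hd.separableSpace
  have : SecondCountableTopology Heis := UniformSpace.secondCountable_of_separable Heis
  set μ : Measure Heis := (volume.restrict O).map γ with hμ
  have hμapply : ∀ (p : Heis) (ρ : ℝ), μ (Metric.closedBall p ρ) =
      volume {s ∈ O | γ s ∈ Metric.closedBall p ρ} := by
    intro p ρ
    rw [hμ, Measure.map_apply_of_aemeasurable hmeas measurableSet_closedBall,
      Measure.restrict_apply' hO.measurableSet, inter_comm]
    rfl
  have hμuniv : μ univ = volume O := by
    rw [hμ, Measure.map_apply_of_aemeasurable hmeas MeasurableSet.univ]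
    simp
  have : IsFiniteMeasure μ := ⟨by rw [hμuniv]; exact hfin.lt_top⟩
  let T : Set ((Heis × Heis) × ℝ) := {b | 0 < b.2 ∧ b.2 ≤ ε ∧ dist b.1.1 b.1.2 ≤ b.2 ∧
    a * ENNReal.ofReal (b.2 ^ 2) ≤ Q * μ (Metric.closedBall b.1.2 b.2)}
  have hvitali : ∃ u ⊆ T, u.Countable ∧
      u.PairwiseDisjoint (fun b => Metric.closedBall b.1.2 b.2) ∧
      μ (γ '' O \ ⋃ b ∈ u, Metric.closedBall b.1.2 b.2) = 0 := by
    refine Vitali.exists_disjoint_covering_ae μ (γ '' O) T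
      (beta * (36 * Q) * a⁻¹ * Q).toNNReal (fun b => 2 * b.2) (fun b => b.1.1)
      (fun b => Metric.closedBall b.1.2 b.2) ?_ ?_ ?_ ?_ ?_
    · rintro b ⟨hb0, hbε, hbd, hb⟩ z hz
      have hz' : dist z b.1.2 ≤ b.2 := hz
      rw [Metric.mem_closedBall]
      linarith [dist_triangle_right z b.1.1 b.1.2]
    · rintro b ⟨hb0, hbε, hbd, hb⟩
      rw [ENNReal.coe_toNNReal (by finiteness), hμapply]
      refine (h.volume_mem_closedBall_le hκ0 hκ hC hd _ (by positivity)).trans ?_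
      have e1 : ENNReal.ofReal ((q * (3 * (2 * b.2))) ^ 2) =
          36 * Q * (a⁻¹ * (a * ENNReal.ofReal (b.2 ^ 2))) := by
        rw [← mul_assoc a⁻¹, ENNReal.inv_mul_cancel ha0 ha', one_mul, hQ,
          show (36 : ℝ≥0∞) = ENNReal.ofReal 36 by simp, ← ENNReal.ofReal_mul (by norm_num),
          ← ENNReal.ofReal_mul (by positivity)]
        congr 1; ring
      rw [← hq, e1]
      calc beta * (36 * Q * (a⁻¹ * (a * ENNReal.ofReal (b.2 ^ 2))))
          ≤ beta * (36 * Q * (a⁻¹ * (Q * μ (Metric.closedBall b.1.2 b.2)))) := by gcongr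
        _ = _ := by ring
    · rintro b ⟨hb0, -⟩
      exact ⟨b.1.2, Metric.ball_subset_interior_closedBall (Metric.mem_ball_self hb0)⟩
    · exact fun _ _ => Metric.isClosed_closedBall
    · rintro _ ⟨t, ht, rfl⟩ δ hδ
      obtain ⟨p, ρ, hρ0, hρ, hd1, hm⟩ := h.exists_closedBall hκ0 hC hd hO ht hy
        (lt_min hε (half_pos hδ))
      refine ⟨((γ t, p), ρ), ⟨hρ0, hρ.trans (min_le_left _ _), hd1, ?_⟩, ?_, rfl⟩
      · rw [hμapply]
        refine le_trans ?_ hm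
        rw [mul_comm]
        gcongr
      · have := hρ.trans (min_le_right _ _)
        dsimp only
        linarith
  obtain ⟨u, huT, hucount, hudisj, hunull⟩ := hvitali
  -- the selected balls have total weight at most the measure of the set of parameters
  set W := ⋃ b ∈ u, Metric.closedBall b.1.2 b.2 with hW
  have h1 : a * sphericalPre Heis beta ε W ≤ beta * (Q * volume O) := by
    have := hucount.to_subtype
    have e1 : sphericalPre Heis beta ε W ≤
        ∑' b : u, beta * ENNReal.ofReal ((b : (Heis × Heis) × ℝ).2 ^ 2) := by
      rw [← sphericalPreOuter_apply beta hε, hW, biUnion_eq_iUnion]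
      refine (measure_iUnion_le _).trans (ENNReal.tsum_le_tsum fun b => ?_)
      obtain ⟨hb0, hbε, -⟩ := huT b.2
      exact sphericalPre_closedBall_le beta hb0.le hbε _
    calc a * sphericalPre Heis beta ε W
        ≤ a * ∑' b : u, beta * ENNReal.ofReal ((b : (Heis × Heis) × ℝ).2 ^ 2) := by gcongr
      _ = beta * ∑' b : u, a * ENNReal.ofReal ((b : (Heis × Heis) × ℝ).2 ^ 2) := by
          rw [ENNReal.tsum_mul_left, ENNReal.tsum_mul_left]; ring
      _ ≤ beta * ∑' b : u, Q * μ (Metric.closedBall (b : (Heis × Heis) × ℝ).1.2 b.1.2) := by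
          refine mul_le_mul_right (ENNReal.tsum_le_tsum fun b => ?_) _
          exact (huT b.2).2.2.2
      _ = beta * (Q * μ W) := by
          rw [ENNReal.tsum_mul_left, hW,
            measure_biUnion hucount hudisj fun _ _ => measurableSet_closedBall]
      _ ≤ beta * (Q * volume O) := by
          rw [← hμuniv]; gcongr; exact subset_univ _
  have h2 : sphericalPre Heis beta ε (γ '' {s ∈ O | γ s ∉ W}) = 0 := by
    have e1 : volume {s ∈ O | γ s ∉ W} = 0 := by
      have := le_antisymm ((Measure.le_map_apply hmeas _).trans hunull.le) zero_le
      rw [Measure.restrict_apply' hO.measurableSet] at this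
      refine measure_mono_null ?_ this
      rintro s ⟨hsO, hsW⟩
      exact ⟨⟨mem_image_of_mem γ hsO, hsW⟩, hsO⟩
    refine le_antisymm ?_ zero_le
    refine (sphericalPre_image_le hC.beta_ne_zero hβ hε hC.nine_mul_sq_pos
      (h.dist_sq_le hκ hC hd) (sep_subset _ _)).trans ?_
    rw [e1, mul_zero]
  have h3 : sphericalPre Heis beta ε (γ '' O) ≤ sphericalPre Heis beta ε W := by
    have hsub : γ '' O ⊆ W ∪ γ '' {s ∈ O | γ s ∉ W} := by
      rintro _ ⟨s, hs, rfl⟩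
      by_cases hsW : γ s ∈ W
      · exact Or.inl hsW
      · exact Or.inr ⟨s, ⟨hs, hsW⟩, rfl⟩
    calc sphericalPreOuter Heis beta hε (γ '' O) ≤ _ :=
          (measure_mono hsub).trans (measure_union_le _ _)
      _ = sphericalPre Heis beta ε W := by
          rw [sphericalPreOuter_apply, sphericalPreOuter_apply, h2, add_zero]
  exact (mul_le_mul_right h3 a).trans h1

theorem IsAlmostVertical.sphericalPre_image_le_of_isOpen [MeasurableSpace Heis] [BorelSpace Heis]
    {κ C : ℝ} {γ : ℝ → Heis} {O : Set ℝ} (h : IsAlmostVertical κ γ O) (hκ0 : 0 ≤ κ)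
    (hκ : κ ≤ 1 / 2) (hC : IsComparable C) (hd : IsHomogeneousDist) (hO : IsOpen O)
    (hfin : volume O ≠ ∞) {ε : ℝ} (hε : 0 < ε) :
    sphericalPre Heis beta ε (γ '' O) ≤ ENNReal.ofReal (distortion C κ ^ 2) * volume O := by
  have hβ0 := hC.beta_ne_zero
  have : (𝓝[<] (beta : ℝ≥0∞)).NeBot :=
    nhdsLT_neBot_of_exists_lt ⟨0, pos_iff_ne_zero.2 hβ0⟩
  have hlim : Tendsto (fun a => a * sphericalPre Heis beta ε (γ '' O)) (𝓝[<] beta)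
      (𝓝 (beta * sphericalPre Heis beta ε (γ '' O))) :=
    (ENNReal.Tendsto.mul_const tendsto_id (Or.inl hβ0)).mono_left nhdsWithin_le_nhds
  have hle := le_of_tendsto hlim (by
    filter_upwards [Ioo_mem_nhdsLT (pos_iff_ne_zero.2 hβ0)] with a ha
    exact h.mul_sphericalPre_le hκ0 hκ hC hd hO hfin hε ha.1.ne' ha.2)
  exact (ENNReal.mul_le_mul_iff_right hβ0 hC.beta_ne_top).1 hle

theorem IsAlmostVertical.sphericalPre_image_le [MeasurableSpace Heis] [BorelSpace Heis]
    {κ C : ℝ} {γ : ℝ → Heis} {J : Set ℝ} (h : IsAlmostVertical κ γ J) (hκ0 : 0 ≤ κ)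
    (hκ : κ ≤ 1 / 2) (hC : IsComparable C) (hd : IsHomogeneousDist)
    (hJ : volume (frontier J) = 0) (hfin : volume J ≠ ∞) {ε : ℝ} (hε : 0 < ε) {E : Set ℝ}
    (hE : E ⊆ J) :
    sphericalPre Heis beta ε (γ '' E) ≤ ENNReal.ofReal (distortion C κ ^ 2) * volume E := by
  have hbdry : sphericalPre Heis beta ε (γ '' (J ∩ frontier J)) = 0 := by
    refine le_antisymm ((_root_.sphericalPre_image_le hC.beta_ne_zero hC.beta_ne_top hε
      hC.nine_mul_sq_pos (h.dist_sq_le hκ hC hd) inter_subset_left).trans ?_) zero_le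
    rw [measure_mono_null inter_subset_right hJ, mul_zero]
  rw [E.measure_eq_iInf_isOpen volume]
  have hQ : ENNReal.ofReal (distortion C κ ^ 2) ≠ 0 := by
    have := one_le_distortion (κ := κ) hC.1
    rw [Ne, ENNReal.ofReal_eq_zero, not_le]; positivity
  simp only [ENNReal.mul_iInf_of_ne hQ ENNReal.ofReal_ne_top]
  refine le_iInf fun U => le_iInf fun hEU => le_iInf fun hU => ?_
  have hsub : γ '' E ⊆ γ '' (U ∩ interior J) ∪ γ '' (J ∩ frontier J) := by
    rintro _ ⟨s, hs, rfl⟩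
    by_cases hsi : s ∈ interior J
    · exact Or.inl ⟨s, ⟨hEU hs, hsi⟩, rfl⟩
    · exact Or.inr ⟨s, ⟨hE hs, subset_closure (hE hs), hsi⟩, rfl⟩
  calc sphericalPreOuter Heis beta hε (γ '' E) ≤ _ :=
        (measure_mono hsub).trans (measure_union_le _ _)
    _ = sphericalPre Heis beta ε (γ '' (U ∩ interior J)) := by
        rw [sphericalPreOuter_apply, sphericalPreOuter_apply, hbdry, add_zero]
    _ ≤ ENNReal.ofReal (distortion C κ ^ 2) * volume (U ∩ interior J) :=
        (h.mono (inter_subset_right.trans interior_subset)).sphericalPre_image_le_of_isOpen hκ0 hκ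
          hC hd (hU.inter isOpen_interior) (ne_top_of_le_ne_top hfin
            (measure_mono (inter_subset_right.trans interior_subset))) hε
    _ ≤ _ := by gcongr; exact inter_subset_left

end Heis

/-! ### Curves with a continuous vertical velocity -/

/-- An inequality between measures which holds near every point of a set holds on the set. -/
theorem measure_le_of_locally_le {μ ν : Measure ℝ} {S : Set ℝ}
    (h : ∀ t ∈ S, ∃ V : Set ℝ, IsOpen V ∧ t ∈ V ∧
      ∀ E ⊆ V ∩ S, MeasurableSet E → μ E ≤ ν E)
    {E : Set ℝ} (hES : E ⊆ S) (hE : MeasurableSet E) : μ E ≤ ν E := by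
  choose! V hVo hVm hV using h
  obtain ⟨T, hTS, hTc, hT⟩ := TopologicalSpace.countable_cover_nhdsWithin (f := V) (s := S)
    fun t ht => mem_nhdsWithin_of_mem_nhds ((hVo t ht).mem_nhds (hVm t ht))
  rcases T.eq_empty_or_nonempty with rfl | hTne
  · have : E = ∅ := subset_empty_iff.1 (hES.trans (by simpa using hT))
    simp [this]
  obtain ⟨f, rfl⟩ := hTc.exists_eq_range hTne
  have hfS : ∀ n, f n ∈ S := fun n => hTS (mem_range_self n)
  have hdm : ∀ n, MeasurableSet (E ∩ disjointed (fun n => V (f n)) n) := fun n =>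
    hE.inter (MeasurableSet.disjointed (fun n => (hVo _ (hfS n)).measurableSet) n)
  have hdd : Pairwise (Function.onFun Disjoint fun n => E ∩ disjointed (fun n => V (f n)) n) :=
    fun m n hmn => (disjoint_disjointed _ hmn).mono inter_subset_right inter_subset_right
  have hEu : E = ⋃ n, E ∩ disjointed (fun n => V (f n)) n := by
    rw [← inter_iUnion, iUnion_disjointed]
    refine (inter_eq_left.2 (hES.trans ?_)).symm
    simpa only [biUnion_range] using hT
  rw [hEu, measure_iUnion hdd hdm, measure_iUnion hdd hdm]
  exact ENNReal.tsum_le_tsum fun n => hV _ (hfS n) _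
    (fun s hs => ⟨disjointed_subset _ n hs.2, hES hs.1⟩) (hdm n)

theorem ENNReal.le_of_forall_one_lt_le_ofReal_mul {a b : ℝ≥0∞}
    (h : ∀ Q : ℝ, 1 < Q → a ≤ ENNReal.ofReal (Q ^ 2) * b) : a ≤ b := by
  have hlim : Tendsto (fun Q : ℝ => ENNReal.ofReal (Q ^ 2) * b) (𝓝[>] 1)
      (𝓝 (ENNReal.ofReal (1 ^ 2) * b)) := by
    refine ENNReal.Tendsto.mul_const ?_ (Or.inl (by simp))
    have : Continuous fun Q : ℝ => ENNReal.ofReal (Q ^ 2) :=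
      ENNReal.continuous_ofReal.comp (by fun_prop)
    exact (this.tendsto 1).mono_left nhdsWithin_le_nhds
  rw [one_pow, ENNReal.ofReal_one, one_mul] at hlim
  exact ge_of_tendsto hlim (by filter_upwards [self_mem_nhdsWithin] with Q hQ using h Q hQ)

theorem ContinuousOn.measurableSet_inter_preimage {α β : Type*} [TopologicalSpace α]
    [MeasurableSpace α] [OpensMeasurableSpace α] [TopologicalSpace β] [MeasurableSpace β]
    [BorelSpace β] {f : α → β} {s : Set α} {U : Set β} (hf : ContinuousOn f s)
    (hs : MeasurableSet s) (hU : MeasurableSet U) : MeasurableSet (s ∩ f ⁻¹' U) := by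
  rw [← Subtype.image_preimage_coe]
  exact hs.subtype_image ((continuousOn_iff_continuous_domRestrict.1 hf).measurable hU)

namespace Heis

/-- At every point of `I` the curve `γ` has the vertical velocity `ϑ` and no horizontal velocity,
in the uniform sense: near `t₀`, increments over a time `h` are within `O(b h)` of `ϑ t₀ * h`
vertically, and at most `√(b h)` horizontally, for every `b > 0`. -/
def HasVerticalVelocity (γ : ℝ → Heis) (ϑ : ℝ → ℝ) (I : Set ℝ) : Prop :=
  ∀ t₀ ∈ I, ∀ b > 0, ∃ δ > 0, ∀ s ∈ Metric.ball t₀ δ ∩ I, |ϑ s - ϑ t₀| ≤ b ∧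
    ∀ t ∈ Metric.ball t₀ δ ∩ I, hGauge ((γ s)⁻¹ * γ t) ≤ √(b * |t - s|) ∧
      |((γ s)⁻¹ * γ t).x3 - ϑ t₀ * (t - s)| ≤ 2 * b * |t - s|

theorem hasVerticalVelocity {I : Set ℝ} (hI : I.OrdConnected) {γ : ℝ → Heis} {ϑ : ℝ → ℝ}
    (hϑ : ContinuousOn ϑ I) {ω : ℝ → ℝ} (hω_zero : Tendsto ω (𝓝[>] 0) (𝓝 0))
    (h_hor : ∀ s ∈ I, ∀ t ∈ I, hGauge ((γ s)⁻¹ * γ t) ≤ √(|t - s| * ω |t - s|))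
    (h_ver : ∀ s ∈ I, ∀ t ∈ I,
      |((γ s)⁻¹ * γ t).x3 - ∫ τ in s..t, ϑ τ| ≤ |t - s| * ω |t - s|) :
    HasVerticalVelocity γ ϑ I := by
  intro t₀ ht₀ b hb
  obtain ⟨δ₁, hδ₁, h₁⟩ := Metric.continuousWithinAt_iff.1 (hϑ t₀ ht₀) b hb
  obtain ⟨δ₂, hδ₂, h₂⟩ := mem_nhdsGT_iff_exists_Ioo_subset.1 (hω_zero.eventually_lt_const hb)
  have hδ₂' : 0 < δ₂ := hδ₂
  refine ⟨min δ₁ (δ₂ / 2), by positivity, fun s hs => ⟨?_, fun t ht => ?_⟩⟩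
  · have := h₁ hs.2 (lt_of_lt_of_le hs.1 (min_le_left _ _))
    rw [Real.dist_eq] at this
    exact this.le
  have hst : |t - s| < δ₂ := by
    have e1 : dist s t₀ < δ₂ / 2 := lt_of_lt_of_le hs.1 (min_le_right _ _)
    have e2 : dist t t₀ < δ₂ / 2 := lt_of_lt_of_le ht.1 (min_le_right _ _)
    have e3 := dist_triangle_right t s t₀
    rw [Real.dist_eq t s] at e3
    linarith
  have hω : |t - s| * ω |t - s| ≤ b * |t - s| := by
    rcases (abs_nonneg (t - s)).eq_or_lt with h0 | h0
    · rw [← h0]; simp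
    · rw [mul_comm]
      have : ω |t - s| < b := h₂ ⟨h0, hst⟩
      gcongr
  refine ⟨(h_hor s hs.2 t ht.2).trans (Real.sqrt_le_sqrt hω), ?_⟩
  have hsub : uIcc s t ⊆ Metric.ball t₀ (min δ₁ (δ₂ / 2)) ∩ I :=
    ((convex_ball _ _).ordConnected.inter hI).uIcc_subset hs ht
  have hint : IntervalIntegrable ϑ volume s t :=
    (hϑ.mono (hsub.trans inter_subset_right)).intervalIntegrable
  have e1 : |(∫ τ in s..t, ϑ τ) - ϑ t₀ * (t - s)| ≤ b * |t - s| := by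
    have e2 : (∫ τ in s..t, ϑ τ) - ϑ t₀ * (t - s) = ∫ τ in s..t, (ϑ τ - ϑ t₀) := by
      rw [intervalIntegral.integral_sub hint intervalIntegrable_const,
        intervalIntegral.integral_const, smul_eq_mul, mul_comm]
    rw [e2, ← Real.norm_eq_abs]
    refine intervalIntegral.norm_integral_le_of_norm_le_const fun τ hτ => ?_
    have hτ' := hsub (uIoc_subset_uIcc hτ)
    have := h₁ hτ'.2 (lt_of_lt_of_le hτ'.1 (min_le_left _ _))
    rw [Real.dist_eq] at this
    exact this.le
  have e3 := abs_sub_le ((γ s)⁻¹ * γ t).x3 (∫ τ in s..t, ϑ τ) (ϑ t₀ * (t - s))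
  linarith [h_ver s hs.2 t ht.2]

theorem exists_distortion_sq_le (C : ℝ) {Q : ℝ} (hQ : 1 < Q) :
    ∃ κ : ℝ, 0 < κ ∧ κ ≤ 1 / 2 ∧ distortion C κ ^ 2 ≤ Q := by
  have hcont : Continuous fun κ : ℝ => distortion C κ ^ 2 := by unfold distortion; fun_prop
  have h1 : ∀ᶠ κ in 𝓝 (0 : ℝ), distortion C κ ^ 2 < Q :=
    (hcont.tendsto 0).eventually_lt_const (by simpa [distortion])
  obtain ⟨κ, hκ, hκ'⟩ := ((h1.filter_mono nhdsWithin_le_nhds).and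
    (Ioc_mem_nhdsGT (by norm_num : (0 : ℝ) < 1 / 2))).exists
  exact ⟨κ, hκ'.1, hκ'.2, hκ.le⟩

section

variable [MetricSpace Heis] {γ : ℝ → Heis} {ϑ : ℝ → ℝ} {I : Set ℝ} {C : ℝ}

theorem HasVerticalVelocity.exists_dist_sq_le (h : HasVerticalVelocity γ ϑ I)
    (hC : IsComparable C) (hd : IsHomogeneousDist) {t₀ : ℝ} (ht₀ : t₀ ∈ I) {b : ℝ} (hb : 0 < b) :
    ∃ δ > 0, ∀ s ∈ Metric.ball t₀ δ ∩ I, ∀ t ∈ Metric.ball t₀ δ ∩ I,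
      dist (γ s) (γ t) ^ 2 ≤ 9 * C ^ 2 * (|ϑ t₀| + b) * |t - s| := by
  obtain ⟨δ, hδ, hst⟩ := h t₀ ht₀ b hb
  refine ⟨δ, hδ, fun s hs t ht => ?_⟩
  obtain ⟨h1, h2⟩ := (hst s hs).2 t ht
  have e0 : 0 ≤ |ϑ t₀| * |t - s| := by positivity
  rw [mul_assoc]
  refine hC.dist_sq_le hd (by positivity) (h1.trans (Real.sqrt_le_sqrt ?_)) ?_
  · linarith
  · have e1 := abs_sub_abs_le_abs_sub ((γ s)⁻¹ * γ t).x3 (ϑ t₀ * (t - s))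
    rw [abs_mul] at e1
    linarith

theorem HasVerticalVelocity.continuousOn (h : HasVerticalVelocity γ ϑ I)
    (hC : IsComparable C) (hd : IsHomogeneousDist) : ContinuousOn γ I := by
  intro t₀ ht₀
  obtain ⟨δ, hδ, hst⟩ := h.exists_dist_sq_le hC hd ht₀ one_pos
  have := continuousOn_of_dist_sq_le hst t₀ ⟨Metric.mem_ball_self hδ, ht₀⟩
  rwa [inter_comm, continuousWithinAt_inter (Metric.ball_mem_nhds _ hδ)] at this

variable [MeasurableSpace Heis] [BorelSpace Heis]

theorem S2_le {U : Set Heis} (hU : MeasurableSet U) {a : ℝ≥0∞}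
    (h : ∀ ε : ℝ, 0 < ε → sphericalPre Heis beta ε U ≤ a) : S2 U ≤ a := by
  rw [S2, sphericalMeasure_apply _ hU]
  exact iSup₂_le h

theorem sphericalPre_le_S2 {U : Set Heis} (hU : MeasurableSet U) {ε : ℝ} (hε : 0 < ε) :
    sphericalPre Heis beta ε U ≤ S2 U := by
  rw [S2, sphericalMeasure_apply _ hU]
  exact le_iSup₂_of_le ε hε le_rfl

/-- The spherical measure of `γ '' I`, carried to the parameter interval `I`. -/
noncomputable def curveMeasure (γ : ℝ → Heis) (I : Set ℝ) : Measure ℝ :=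
  (S2.comap fun x : I => γ x).map Subtype.val

theorem curveMeasure_apply (hd : IsHomogeneousDist) (hI : MeasurableSet I)
    (hγ : InjOn γ I) (hc : ContinuousOn γ I) {E : Set ℝ} (hEI : E ⊆ I) :
    curveMeasure γ I E = S2 (γ '' E) := by
  have := hd.separableSpace
  have : SecondCountableTopology Heis := UniformSpace.secondCountable_of_separable Heis
  have hemb : MeasurableEmbedding fun x : I => γ x := hc.measurableEmbedding hI hγ
  rw [curveMeasure, (MeasurableEmbedding.subtype_coe hI).map_apply, hemb.comap_apply]
  congr 1
  ext x
  constructor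
  · rintro ⟨t, ht, rfl⟩
    exact ⟨t, ht, rfl⟩
  · rintro ⟨t, ht, rfl⟩
    exact ⟨⟨t, hEI ht⟩, ht, rfl⟩

theorem measurableSet_image (hd : IsHomogeneousDist) (hγ : InjOn γ I) (hc : ContinuousOn γ I)
    {E : Set ℝ} (hEI : E ⊆ I) (hE : MeasurableSet E) : MeasurableSet (γ '' E) := by
  have := hd.separableSpace
  have : SecondCountableTopology Heis := UniformSpace.secondCountable_of_separable Heis
  exact hE.image_of_continuousOn_injOn (hc.mono hEI) (hγ.mono hEI)

/-- The part of the curve with vanishing vertical velocity is negligible, since there the curve is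
`1/2`-Hölder with arbitrarily small constants. -/
theorem HasVerticalVelocity.S2_image_eq_zero (h : HasVerticalVelocity γ ϑ I)
    (hC : IsComparable C) (hd : IsHomogeneousDist) (hI : MeasurableSet I) (hγ : InjOn γ I)
    {E : Set ℝ} (hEI : E ⊆ I ∩ ϑ ⁻¹' {0}) (hE : MeasurableSet E) : S2 (γ '' E) = 0 := by
  have hc := h.continuousOn hC hd
  have hEI' : E ⊆ I := hEI.trans inter_subset_left
  -- the estimate with a small Hölder constant, for every measurable part of the set
  have key : ∀ b : ℝ, 0 < b → ∀ F ⊆ E, MeasurableSet F →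
      curveMeasure γ I F ≤ (beta * ENNReal.ofReal (9 * C ^ 2 * b)) * volume F := by
    intro b hb F hFE hF
    have := measure_le_of_locally_le (μ := curveMeasure γ I)
      (ν := (beta * ENNReal.ofReal (9 * C ^ 2 * b)) • volume) (S := E) (fun t ht => ?_) hFE hF
    · simpa using this
    obtain ⟨δ, hδ, hst⟩ := h.exists_dist_sq_le hC hd (hEI ht).1 hb
    refine ⟨Metric.ball t δ, Metric.isOpen_ball, Metric.mem_ball_self hδ, fun G hG hGm => ?_⟩
    have hGE : G ⊆ E := hG.trans inter_subset_right
    rw [curveMeasure_apply hd hI hγ hc (hGE.trans hEI')]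
    refine S2_le (measurableSet_image hd hγ hc (hGE.trans hEI') hGm) fun ε hε => ?_
    rw [show ϑ t = 0 from (hEI ht).2, abs_zero, zero_add] at hst
    exact sphericalPre_image_le hC.beta_ne_zero hC.beta_ne_top hε
      (mul_pos hC.nine_mul_sq_pos hb) hst fun s hs => ⟨(hG hs).1, hEI' (hGE hs)⟩
  rw [← curveMeasure_apply hd hI hγ hc hEI']
  refine measure_null_of_locally_null E fun t ht =>
    ⟨E ∩ Metric.closedBall t 1, inter_mem_nhdsWithin _ (Metric.closedBall_mem_nhds _ one_pos), ?_⟩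
  have hfin : volume (E ∩ Metric.closedBall t 1) ≠ ∞ :=
    ne_top_of_le_ne_top (isCompact_closedBall t 1).measure_ne_top (measure_mono inter_subset_right)
  have hlim : Tendsto (fun b : ℝ => beta * ENNReal.ofReal (9 * C ^ 2 * b) *
      volume (E ∩ Metric.closedBall t 1)) (𝓝[>] 0) (𝓝 0) := by
    have e1 : Tendsto (fun b : ℝ => ENNReal.ofReal (9 * C ^ 2 * b)) (𝓝[>] 0) (𝓝 0) := by
      have : Continuous fun b : ℝ => ENNReal.ofReal (9 * C ^ 2 * b) :=
        ENNReal.continuous_ofReal.comp (by fun_prop)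
      simpa using (this.tendsto 0).mono_left nhdsWithin_le_nhds
    have e2 := ENNReal.Tendsto.mul_const (ENNReal.Tendsto.const_mul e1 (Or.inr hC.beta_ne_top))
      (b := volume (E ∩ Metric.closedBall t 1)) (Or.inr hfin)
    simpa using e2
  refine le_antisymm (ge_of_tendsto hlim ?_) zero_le
  filter_upwards [self_mem_nhdsWithin] with b hb
  exact key b hb _ inter_subset_left (hE.inter measurableSet_closedBall)

/-- Near a parameter with `ϑ t₀ ≠ 0` the curve is almost vertical, once the parameter is rescaled
by the vertical velocity `ϑ t₀`. -/
theorem HasVerticalVelocity.exists_S2_image_le (h : HasVerticalVelocity γ ϑ I)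
    (hC : IsComparable C) (hd : IsHomogeneousDist) (hI : I.OrdConnected) (hγ : InjOn γ I)
    {t₀ : ℝ} (ht₀ : t₀ ∈ I) (hθ : ϑ t₀ ≠ 0) {Q : ℝ} (hQ : 1 < Q) :
    ∃ δ > 0, (∀ s ∈ Metric.ball t₀ δ ∩ I, |ϑ s| ≤ Q * |ϑ t₀| ∧ |ϑ t₀| ≤ Q * |ϑ s|) ∧
      ∀ E ⊆ Metric.ball t₀ δ ∩ I, MeasurableSet E →
        S2 (γ '' E) ≤ ENNReal.ofReal Q * (ENNReal.ofReal |ϑ t₀| * volume E) ∧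
        ENNReal.ofReal |ϑ t₀| * volume E ≤ ENNReal.ofReal Q * S2 (γ '' E) := by
  set θ := ϑ t₀ with hθdef
  have hθ0 : 0 < |θ| := abs_pos.2 hθ
  obtain ⟨κ, hκ0, hκ, hκQ⟩ := exists_distortion_sq_le C hQ
  have hQ0 : 0 < Q := one_pos.trans hQ
  have hQ1 : 0 < 1 - Q⁻¹ := sub_pos.2 (inv_lt_one_of_one_lt₀ hQ)
  obtain ⟨δ, hδ, hst⟩ := h t₀ ht₀ (min (κ / 2 * |θ|) ((1 - Q⁻¹) * |θ|)) (by positivity)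
  have hmin1 := min_le_left (κ / 2 * |θ|) ((1 - Q⁻¹) * |θ|)
  have hmin2 := min_le_right (κ / 2 * |θ|) ((1 - Q⁻¹) * |θ|)
  set b := min (κ / 2 * |θ|) ((1 - Q⁻¹) * |θ|)
  refine ⟨δ, hδ, fun s hs => ?_, fun E hE hEm => ?_⟩
  · have h1 := (hst s hs).1
    have h2 := abs_sub_abs_le_abs_sub (ϑ s) θ
    have h3 := abs_sub_abs_le_abs_sub θ (ϑ s)
    rw [abs_sub_comm θ] at h3
    have h4 : Q * Q⁻¹ = 1 := mul_inv_cancel₀ hQ0.ne'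
    constructor
    · have h5 : 2 - Q⁻¹ ≤ Q := by
        rw [← sub_nonneg, ← mul_nonneg_iff_of_pos_left hQ0]
        nlinarith [sq_nonneg (Q - 1)]
      nlinarith
    · have h6 : Q⁻¹ * |θ| ≤ |ϑ s| := by linarith
      calc |θ| = Q * (Q⁻¹ * |θ|) := by rw [← mul_assoc, h4, one_mul]
        _ ≤ Q * |ϑ s| := by gcongr
  set K := Metric.ball t₀ δ ∩ I with hK
  set J := (fun τ : ℝ => θ⁻¹ * τ) ⁻¹' K with hJ
  set γ' : ℝ → Heis := fun τ => γ (θ⁻¹ * τ) with hγ'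
  have hvert : IsAlmostVertical κ γ' J := by
    intro s hs t ht
    obtain ⟨h1, h2⟩ := (hst _ hs).2 _ ht
    have e1 : |θ⁻¹ * t - θ⁻¹ * s| = |θ|⁻¹ * |t - s| := by rw [← mul_sub, abs_mul, abs_inv]
    have e2 : θ * (θ⁻¹ * t - θ⁻¹ * s) = t - s := by field_simp
    have e3 : 2 * b * |θ⁻¹ * t - θ⁻¹ * s| ≤ κ * |t - s| := by
      rw [e1]
      calc 2 * b * (|θ|⁻¹ * |t - s|) ≤ 2 * (κ / 2 * |θ|) * (|θ|⁻¹ * |t - s|) := by gcongr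
        _ = κ * |t - s| := by field_simp
    rw [e2] at h2
    refine ⟨h1.trans (Real.sqrt_le_sqrt ?_), h2.trans e3⟩
    have e4 : 0 ≤ κ * |t - s| := by positivity
    linarith
  have hKconv : Convex ℝ K := (convex_ball t₀ δ).inter hI.convex
  have hJfr : volume (frontier J) = 0 := (hKconv.smul_preimage θ⁻¹).addHaar_frontier volume
  have hvol : ∀ F : Set ℝ, volume ((fun τ : ℝ => θ⁻¹ * τ) ⁻¹' F) =
      ENNReal.ofReal |θ| * volume F := by
    intro F
    rw [Real.volume_preimage_mul_left (inv_ne_zero hθ), inv_inv]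
  have hJfin : volume J ≠ ∞ := by
    rw [hJ, hvol]
    exact ENNReal.mul_ne_top ENNReal.ofReal_ne_top (ne_top_of_le_ne_top
      (measure_ball_lt_top (x := t₀) (r := δ)).ne (measure_mono inter_subset_left))
  have himage : γ '' E = γ' '' ((fun τ : ℝ => θ⁻¹ * τ) ⁻¹' E) := by
    rw [hγ', ← image_image γ fun τ : ℝ => θ⁻¹ * τ, image_preimage_eq]
    exact fun t => ⟨θ * t, by field_simp⟩
  have hEJ : (fun τ : ℝ => θ⁻¹ * τ) ⁻¹' E ⊆ J := preimage_mono hE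
  have hmeas := measurableSet_image hd hγ (h.continuousOn hC hd) (hE.trans inter_subset_right) hEm
  have hofQ : ENNReal.ofReal (distortion C κ ^ 2) ≤ ENNReal.ofReal Q := ENNReal.ofReal_le_ofReal hκQ
  rw [← hvol]
  constructor
  · refine S2_le hmeas fun ε hε => ?_
    rw [himage]
    exact (hvert.sphericalPre_image_le hκ0.le hκ hC hd hJfr hJfin hε hEJ).trans (by gcongr)
  · refine (hvert.volume_le_sphericalPre hκ0.le hκ hC hd 1 hEJ).trans ?_
    rw [← himage]
    gcongr
    exact sphericalPre_le_S2 hmeas one_pos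

/-- The area formula for sets of parameters. -/
theorem HasVerticalVelocity.S2_image (h : HasVerticalVelocity γ ϑ I)
    (hd : IsHomogeneousDist) (hI : I.OrdConnected) (hγ : InjOn γ I) (hϑ : ContinuousOn ϑ I)
    {E : Set ℝ} (hEI : E ⊆ I) (hE : MeasurableSet E) :
    S2 (γ '' E) = ∫⁻ τ in E, ENNReal.ofReal |ϑ τ| := by
  obtain ⟨C, hC⟩ := hd.exists_isComparable
  have hc := h.continuousOn hC hd
  have hIm := hI.measurableSet
  have hzero : MeasurableSet (I ∩ ϑ ⁻¹' {0}) :=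
    hϑ.measurableSet_inter_preimage hIm (measurableSet_singleton 0)
  set lam : Measure ℝ := volume.withDensity fun τ => ENNReal.ofReal |ϑ τ| with hlam
  have hlam_apply : ∀ F : Set ℝ, MeasurableSet F → lam F = ∫⁻ τ in F, ENNReal.ofReal |ϑ τ| :=
    fun F hF => withDensity_apply _ hF
  -- the part where the velocity vanishes
  have h0 : curveMeasure γ I (E ∩ (I ∩ ϑ ⁻¹' {0})) = lam (E ∩ (I ∩ ϑ ⁻¹' {0})) := by
    have hm := hE.inter hzero
    rw [curveMeasure_apply hd hIm hγ hc (inter_subset_left.trans hEI),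
      h.S2_image_eq_zero hC hd hIm hγ inter_subset_right hm, hlam_apply _ hm,
      setLIntegral_congr_fun (g := fun _ => 0) hm fun s hs => ?_, lintegral_zero]
    have : ϑ s = 0 := hs.2.2
    simp [this]
  -- the part where it does not vanish, up to factors close to one
  have h1 : ∀ Q : ℝ, 1 < Q → ∀ t ∈ I \ (I ∩ ϑ ⁻¹' {0}), ∃ V : Set ℝ, IsOpen V ∧ t ∈ V ∧
      ∀ F ⊆ V ∩ (I \ (I ∩ ϑ ⁻¹' {0})), MeasurableSet F →
        curveMeasure γ I F ≤ (ENNReal.ofReal (Q ^ 2) • lam) F ∧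
        lam F ≤ (ENNReal.ofReal (Q ^ 2) • curveMeasure γ I) F := by
    intro Q hQ t ht
    have hQ0 : 0 ≤ Q := by linarith
    have hQ2 : ENNReal.ofReal (Q ^ 2) = ENNReal.ofReal Q * ENNReal.ofReal Q := by
      rw [sq, ENNReal.ofReal_mul hQ0]
    have hθ : ϑ t ≠ 0 := fun h' => ht.2 ⟨ht.1, h'⟩
    obtain ⟨δ, hδ, hb, hS⟩ := h.exists_S2_image_le hC hd hI hγ ht.1 hθ hQ
    refine ⟨Metric.ball t δ, Metric.isOpen_ball, Metric.mem_ball_self hδ, fun F hF hFm => ?_⟩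
    have hFK : F ⊆ Metric.ball t δ ∩ I := fun s hs => ⟨(hF hs).1, (hF hs).2.1⟩
    obtain ⟨hS1, hS2⟩ := hS F hFK hFm
    rw [Measure.smul_apply, Measure.smul_apply, smul_eq_mul, smul_eq_mul,
      curveMeasure_apply hd hIm hγ hc (hFK.trans inter_subset_right), hlam_apply F hFm]
    have e1 : ENNReal.ofReal |ϑ t| * volume F ≤
        ENNReal.ofReal Q * ∫⁻ τ in F, ENNReal.ofReal |ϑ τ| := by
      rw [← setLIntegral_const, ← lintegral_const_mul' _ _ ENNReal.ofReal_ne_top]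
      refine setLIntegral_mono' hFm fun s hs => ?_
      rw [← ENNReal.ofReal_mul hQ0]
      exact ENNReal.ofReal_le_ofReal (hb s (hFK hs)).2
    have e2 : ∫⁻ τ in F, ENNReal.ofReal |ϑ τ| ≤
        ENNReal.ofReal Q * (ENNReal.ofReal |ϑ t| * volume F) := by
      rw [← mul_assoc, ← setLIntegral_const]
      refine setLIntegral_mono' hFm fun s hs => ?_
      rw [← ENNReal.ofReal_mul hQ0]
      exact ENNReal.ofReal_le_ofReal (hb s (hFK hs)).1
    rw [hQ2, mul_assoc, mul_assoc]
    exact ⟨hS1.trans (by gcongr), e2.trans (by gcongr)⟩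
  have hm : MeasurableSet (E \ (I ∩ ϑ ⁻¹' {0})) := hE.diff hzero
  have hsub : E \ (I ∩ ϑ ⁻¹' {0}) ⊆ I \ (I ∩ ϑ ⁻¹' {0}) := sdiff_subset_sdiff_left hEI
  have h2 : curveMeasure γ I (E \ (I ∩ ϑ ⁻¹' {0})) = lam (E \ (I ∩ ϑ ⁻¹' {0})) := by
    refine le_antisymm (ENNReal.le_of_forall_one_lt_le_ofReal_mul fun Q hQ => ?_)
      (ENNReal.le_of_forall_one_lt_le_ofReal_mul fun Q hQ => ?_)
    · refine measure_le_of_locally_le (ν := ENNReal.ofReal (Q ^ 2) • lam) (fun t ht => ?_) hsub hm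
      obtain ⟨V, hV, htV, hF⟩ := h1 Q hQ t ht
      exact ⟨V, hV, htV, fun F h' h'' => (hF F h' h'').1⟩
    · refine measure_le_of_locally_le (ν := ENNReal.ofReal (Q ^ 2) • curveMeasure γ I)
        (fun t ht => ?_) hsub hm
      obtain ⟨V, hV, htV, hF⟩ := h1 Q hQ t ht
      exact ⟨V, hV, htV, fun F h' h'' => (hF F h' h'').2⟩
  rw [← curveMeasure_apply hd hIm hγ hc hEI, ← hlam_apply E hE,
    ← measure_inter_add_sdiff E hzero, ← measure_inter_add_sdiff E hzero, h0, h2]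

/-- The spherical measure on the curve is the image of the measure `|ϑ| dτ`. -/
theorem HasVerticalVelocity.S2_restrict (h : HasVerticalVelocity γ ϑ I)
    (hd : IsHomogeneousDist) (hI : I.OrdConnected) (hγ : InjOn γ I) (hϑ : ContinuousOn ϑ I) :
    AEMeasurable γ ((volume.restrict I).withDensity fun τ => ENNReal.ofReal |ϑ τ|) ∧
    S2.restrict (γ '' I) =
      ((volume.restrict I).withDensity fun τ => ENNReal.ofReal |ϑ τ|).map γ := by
  obtain ⟨C, hC⟩ := hd.exists_isComparable
  have hc := h.continuousOn hC hd
  have hIm := hI.measurableSet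
  have hae : AEMeasurable γ ((volume.restrict I).withDensity fun τ => ENNReal.ofReal |ϑ τ|) :=
    (hc.aemeasurable hIm).mono_ac (withDensity_absolutelyContinuous _ _)
  refine ⟨hae, Measure.ext fun U hU => ?_⟩
  have hm : MeasurableSet (I ∩ γ ⁻¹' U) := hc.measurableSet_inter_preimage hIm hU
  rw [Measure.restrict_apply hU, Measure.map_apply_of_aemeasurable hae hU, inter_comm,
    ← image_inter_preimage, h.S2_image hd hI hγ hϑ inter_subset_left hm]
  have e1 : (volume.restrict I).withDensity (fun τ => ENNReal.ofReal |ϑ τ|) (γ ⁻¹' U) =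
      (volume.restrict I).withDensity (fun τ => ENNReal.ofReal |ϑ τ|) (I ∩ γ ⁻¹' U) := by
    refine measure_congr ?_
    have : ∀ᵐ τ ∂(volume.restrict I).withDensity (fun τ => ENNReal.ofReal |ϑ τ|), τ ∈ I :=
      (withDensity_absolutelyContinuous _ _).ae_le (ae_restrict_mem hIm)
    filter_upwards [this] with τ hτ
    exact propext ⟨fun h => ⟨hτ, h⟩, fun h => h.2⟩
  rw [e1, withDensity_apply _ hm, Measure.restrict_restrict hm,
    inter_eq_left.2 (inter_subset_left : I ∩ γ ⁻¹' U ⊆ I)]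

end

end Heis

theorem theorem7p1 [MetricSpace Heis] [MeasurableSpace Heis] [BorelSpace Heis]
    (hd : Heis.IsHomogeneousDist)
    (I : Set ℝ) (hI : I.OrdConnected)
    (γ : ℝ → Heis) (hγ : InjOn γ I)
    (ϑ : ℝ → ℝ) (hϑ : ContinuousOn ϑ I)
    (ω : ℝ → ℝ) (hω_nonneg : ∀ h, 0 ≤ h → 0 ≤ ω h) (hω_mono : MonotoneOn ω (Ici 0))
    (hω_zero : Tendsto ω (𝓝[>] 0) (𝓝 0))
    (h_hor : ∀ s ∈ I, ∀ t ∈ I,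
      Heis.hGauge ((γ s)⁻¹ * γ t) ≤ Real.sqrt (|t - s| * ω |t - s|))
    (h_ver : ∀ s ∈ I, ∀ t ∈ I,
      |((γ s)⁻¹ * γ t).x3 - ∫ τ in s..t, ϑ τ| ≤ |t - s| * ω |t - s|) :
    (∀ U : Set Heis, MeasurableSet U →
      Heis.S2 (γ '' I ∩ U) =
        ∫⁻ τ in I, U.indicator 1 (γ τ) * ENNReal.ofReal |ϑ τ|) ∧
    (∀ u : Heis → ℝ, Measurable u → (∃ C : ℝ, ∀ x, |u x| ≤ C) →
      (∫⁻ x in γ '' I, ENNReal.ofReal (u x) ∂Heis.S2 =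
        ∫⁻ τ in I, ENNReal.ofReal (u (γ τ)) * ENNReal.ofReal |ϑ τ|) ∧
      (IntegrableOn u (γ '' I) Heis.S2 ↔
        IntegrableOn (fun τ => u (γ τ) * |ϑ τ|) I volume) ∧
      ∫ x in γ '' I, u x ∂Heis.S2 = ∫ τ in I, u (γ τ) * |ϑ τ|) := by
  obtain ⟨hae, hmap⟩ := (Heis.hasVerticalVelocity hI hϑ hω_zero h_hor h_ver).S2_restrict hd hI hγ hϑ
  have hdens : AEMeasurable (fun τ => ENNReal.ofReal |ϑ τ|) (volume.restrict I) := by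
    have := hϑ.aemeasurable (μ := volume) hI.measurableSet
    exact this.abs.ennreal_ofReal
  have hfin : ∀ᵐ τ ∂volume.restrict I, ENNReal.ofReal |ϑ τ| < ∞ :=
    Eventually.of_forall fun _ => ENNReal.ofReal_lt_top
  have hlint : ∀ f : Heis → ℝ≥0∞, Measurable f → ∫⁻ x in γ '' I, f x ∂Heis.S2 =
      ∫⁻ τ in I, f (γ τ) * ENNReal.ofReal |ϑ τ| := by
    intro f hf
    rw [hmap, lintegral_map' hf.aemeasurable hae,
      lintegral_withDensity_eq_lintegral_mul_non_measurable₀ _ hdens hfin]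
    simp only [Pi.mul_apply, mul_comm]
  refine ⟨fun U hU => ?_, fun u hu _ => ⟨hlint _ hu.ennreal_ofReal, ?_, ?_⟩⟩
  · rw [← hlint _ (measurable_one.indicator hU), lintegral_indicator_one hU,
      Measure.restrict_apply hU, inter_comm]
  · rw [IntegrableOn, hmap, integrable_map_measure hu.aestronglyMeasurable hae,
      integrable_withDensity_iff_integrable_smul₀' hdens hfin]
    simp only [ENNReal.toReal_ofReal (abs_nonneg _), Function.comp_apply, smul_eq_mul, mul_comm]
    rfl
  · rw [hmap, integral_map hae hu.aestronglyMeasurable,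
      integral_withDensity_eq_integral_toReal_smul₀ hdens hfin]
    simp only [ENNReal.toReal_ofReal (abs_nonneg _), smul_eq_mul, mul_comm]
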